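/- Consider allocation processes that start with $n$ empty bins, labelled $1,\dots,n$. Let $x^t\in\mathbb{N}^n$ be the load vector after $t$ rounds, $W^t=\sum_i x_i^t$ the total number of balls, and $\mathrm{Gap}(t)=\max_i x_i^t - W^t/n$. In each round all sampled bins are chosen independently and uniformly at random (independently of the past). * Twinning: in round $t\ge 0$ sample a bin $i$; it receives two balls if $x_i^t<W^t/n$ and one ball otherwise. * $k$-Relative-Threshold$(f_1,\dots,f_k)$, for real-valued functions with $\infty=f_0(n)>f_1(n)>\dots>f_k(n)$ for every $n\ge 1$: in round $t\ge 0$ sample two bins $i_1,i_2$ and let $\ell_i=\max\{j\in\{0,\dots,k\}: t/n+f_j(n)>x_i^t\}$; one ball is put into $i_1$ if $\ell_{i_1}\ge \ell_{i_2}$, otherwise into $i_2$. * Mean-Thinning: in round $t\ge 0$ sample two bins $i_1,i_2$; one ball is put into $i_1$ if $x_{i_1}^t<t/n$, otherwise into $i_2$. * $(1+\beta)$-process: in each round, with probability $\beta$ sample two bins and put one ball into the less loaded of the two (in case of a tie, into the one with the higher index); otherwise put one ball into one sampled bin. Let $\mathcal{Q}$ be Twinning, or $k$-Relative-Threshold$(f_1,\dots,f_k)$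 for any $k\ge1$ and any $f_1,\dots,f_k$ as above with $f_k(n)=0$ for all $n\ge 1$, or Mean-Thinning, or the $(1+\beta)$-process for any constant $\beta\in(0,1]$. Then there is a constant $\kappa>0$, which may depend on the process $\mathcal{Q}$ but not on $n$ or $m$, such that for all sufficiently large $n$ (depending only on $\mathcal{Q}$) and every round $m\ge 0$, $$\Pr[\mathrm{Gap}(m)\le \kappa\log n]\ \ge\ 1-n^{-4}.$$ -/

import Mathlib

noncomputable section

namespace BallsBins

/-- A load vector: the number of balls in each of the `n` bins. -/
abbrev Load (n : ℕ) : Type := Fin n → ℕ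

/-- Total number of balls `W = ∑ i, x i`. -/
def totalLoad {n : ℕ} (x : Load n) : ℕ := ∑ i, x i

/-- The mean load `W / n`. -/
def meanLoad {n : ℕ} (x : Load n) : ℝ := (totalLoad x : ℝ) / (n : ℝ)

/-- `Gap = max_i x_i - W / n`. -/
def gap {n : ℕ} [NeZero n] (x : Load n) : ℝ :=
  ((Finset.univ.sup' Finset.univ_nonempty x : ℕ) : ℝ) - meanLoad x

/-- Put `w` further balls into bin `i`. -/
def allocate {n : ℕ} (x : Load n) (i : Fin n) (w : ℕ) : Load n :=
  Function.update x i (x i + w)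

/-- A uniformly random bin. -/
def sampleBin (n : ℕ) [NeZero n] : PMF (Fin n) := PMF.uniformOfFintype (Fin n)

/-- The coin that shows `true` with probability `β` and `false` with probability `1 - β`. -/
def coin (β : unitInterval) : PMF Bool :=
  PMF.ofFintype (fun b => if b then ENNReal.ofReal (β : ℝ) else ENNReal.ofReal (1 - (β : ℝ))) (by
    have h0 : (0 : ℝ) ≤ β := β.2.1
    have h1 : (0 : ℝ) ≤ 1 - (β : ℝ) := sub_nonneg.2 β.2.2
    simp [← ENNReal.ofReal_add h0 h1])

/-- An allocation process, for every number `n ≥ 1` of bins: given the round `t` and the load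
vector after `t` rounds, the conditional distribution of the load vector after `t + 1` rounds. -/
abbrev AllocProcess : Type := (n : ℕ) → [NeZero n] → ℕ → Load n → PMF (Load n)

/-- The distribution of the load vector `x^m` after `m` rounds, starting from empty bins. -/
def loadLaw (Q : AllocProcess) (n : ℕ) [NeZero n] : ℕ → PMF (Load n)
  | 0 => PMF.pure (fun _ => 0)
  | t + 1 => (loadLaw Q n t).bind (Q n t)

/-- `Pr[Gap(m) ≤ r]` for the process `Q` with `n` bins. -/
def probGapLE (Q : AllocProcess) (n : ℕ) [NeZero n] (m : ℕ) (r : ℝ) : ℝ :=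
  (loadLaw Q n m).toMeasure.real {x | gap x ≤ r}

/-- Sample one bin; it receives two balls if its load is below the mean load and one ball
otherwise. -/
def twinning : AllocProcess := fun n _ _t x =>
  (sampleBin n).map fun i => allocate x i (if (x i : ℝ) < meanLoad x then 2 else 1)

/-- One ball is put into a uniformly random bin. -/
def oneChoice : AllocProcess := fun n _ _t x =>
  (sampleBin n).map fun i => allocate x i 1

/-- Sample two bins; one ball is put into the less loaded one, in case of a tie into the one with
the higher index. -/
def twoChoice : AllocProcess := fun n _ _t x =>
  (sampleBin n).bind fun i₁ => (sampleBin n).map fun i₂ =>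
    allocate x (if x i₁ < x i₂ then i₁ else if x i₂ < x i₁ then i₂ else max i₁ i₂) 1

/-- With probability `β` a round of `twoChoice`, otherwise a round of `oneChoice`. -/
def onePlusBeta (β : unitInterval) : AllocProcess := fun n _ t x =>
  (coin β).bind fun b => if b then twoChoice n t x else oneChoice n t x

/-- Sample two bins; one ball is put into the first one if its load is below `t / n`, otherwise
into the second one. -/
def meanThinning : AllocProcess := fun n _ t x =>
  (sampleBin n).bind fun i₁ => (sampleBin n).map fun i₂ =>
    allocate x (if (x i₁ : ℝ) < (t : ℝ) / (n : ℝ) then i₁ else i₂) 1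

/-- `max {j ∈ {0, 1, …, k} : t / n + f_j(n) > x_i}` for a bin of load `x_i = load`. Here `f_0 = ∞`,
so that `j = 0` always belongs to the set; the value `f 0` is not used. -/
def level (k : ℕ) (f : ℕ → ℕ → ℝ) (n t load : ℕ) : ℕ :=
  ((Finset.range (k + 1)).filter
    fun j => j = 0 ∨ (t : ℝ) / (n : ℝ) + f j n > (load : ℝ)).sup id

/-- The `k`-Relative-Threshold process with threshold functions `f 1, …, f k` (each a function of
the number of bins): sample two bins; one ball is put into the first one if its level is at least
the level of the second one, otherwise into the second one. -/
def relativeThreshold (k : ℕ) (f : ℕ → ℕ → ℝ) : AllocProcess := fun n _ t x =>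
  (sampleBin n).bind fun i₁ => (sampleBin n).map fun i₂ =>
    allocate x (if level k f n t (x i₁) ≥ level k f n t (x i₂) then i₁ else i₂) 1

/-- There is a constant `κ > 0` such that `Pr[Gap(m) ≤ κ log n] ≥ 1 - n⁻⁴` for all sufficiently
large `n` and every round `m ≥ 0`. The constants do not depend on `n` and `m`. -/
def HasLogGap (Q : AllocProcess) : Prop :=
  ∃ κ : ℝ, 0 < κ ∧ ∃ n₀ : ℕ, ∀ (n : ℕ) [NeZero n], n₀ ≤ n → ∀ m : ℕ,
    1 - ((n : ℝ) ^ 4)⁻¹ ≤ probGapLE Q n m (κ * Real.log n)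

end BallsBins

end

noncomputable section

namespace BallsBins

open Finset

variable {n : ℕ}

/-! Let `y` be the deviations from the mean. In a `BiasedStep` the sum of `exp (α * y j)` contracts
at rate `α β underFrac / n`, and the sum of `exp (-α * y j)` at rate `α β overFrac / n`, up to
bounded errors. Either rate may be negligible, since almost all bins may lie on one side of the
mean. Two extra factors supply the missing contraction.

The first is `exp (spread)`, built from the square root of the quadratic potential. Since `underFrac
+ overFrac = 1`, the quadratic potential has drift at most `4 - β (∑ |y j|) / n` however the bins
are divided. So the spread drops when `∑ |y j|` is at least a large multiple of `n`, and otherwise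
grows only slightly.

The second is `exp (correction)`, built from the average of the bounded function `tau` of the
deviations. If few bins are below the mean and `∑ |y j|` is `O(n)`, a constant fraction of the bins
is overloaded by `O(1)`, and `tau` drops in expectation on each of them; this beats the growth of
the spread. The mirror image for underloaded bins needs each of them to be chosen with probability
at least `1 / n` (`SamplesUnderloaded`). The `(1+β)`-process lacks this property. There no
correction is used on the lower side, because `FavoursLowerHalf` already gives full contraction when
`∑ |y j|` is `O(n)`.

`BiasedStep.sum_over_le` and `BiasedStep.sum_under_le` carry out this balance, with an error
proportional to `exp (spread)`. If the exponential potentials exceed a multiple of `n`, the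
contraction absorbs this error; otherwise the spread is bounded. So `totalPot` contracts by `1 - c /
n` up to a constant (`exists_sum_totalPot_le`), its expectation stays `O(n)` in every round, and
Markov's inequality bounds the gap (`hasLogGap_of_biasedStep`). It remains to verify the bias:
directly for Twinning, by symmetrising over the ordered pair of samples (`PairRule`) for the others.
-/

/-! ### Biased steps of a deviation vector. -/

/-- The deviations from the mean after `w i` balls are put into bin `i`. -/
def bump {n : ℕ} (y w : Fin n → ℝ) (i : Fin n) : Fin n → ℝ :=
  fun j => y j + w i * ((if j = i then 1 else 0) - 1 / n)

/-- The fraction of bins below the mean. -/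
def underFrac {n : ℕ} (y : Fin n → ℝ) : ℝ := (#{j | y j < 0} : ℝ) / n

/-- The fraction of bins that are not below the mean. -/
def overFrac {n : ℕ} (y : Fin n → ℝ) : ℝ := (#{j | 0 ≤ y j} : ℝ) / n

/-- The expected change of the deviation of bin `i`, if bin `j` is chosen with probability `p j` and
then receives `w j` balls. -/
def drift {n : ℕ} (p w : Fin n → ℝ) (i : Fin n) : ℝ := p i * w i - (∑ j, p j * w j) / n

/-- A step that is biased away from the overloaded and towards the underloaded bins. -/
structure BiasedStep {n : ℕ} (β : ℝ) (y p w : Fin n → ℝ) : Prop where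
  p_nonneg : ∀ i, 0 ≤ p i
  p_sum : ∑ i, p i = 1
  p_le : ∀ i, p i ≤ 2 / n
  one_le_w : ∀ i, 1 ≤ w i
  w_le_two : ∀ i, w i ≤ 2
  drift_over : ∀ φ : Fin n → ℝ, (∀ i, 0 ≤ φ i) → (∀ i, y i < 0 → φ i = 0) →
    (∀ i j, y i ≤ y j → φ i ≤ φ j) →
    ∑ i, drift p w i * φ i ≤ -(β * underFrac y / n * ∑ i, φ i)
  drift_under : ∀ φ : Fin n → ℝ, (∀ i, 0 ≤ φ i) → (∀ i, 0 ≤ y i → φ i = 0) →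
    (∀ i j, y i ≤ y j → φ j ≤ φ i) →
    β * overFrac y / n * ∑ i, φ i ≤ ∑ i, drift p w i * φ i

/-- Every underloaded bin is chosen with probability at least `1 / n`. -/
def SamplesUnderloaded {n : ℕ} (y p : Fin n → ℝ) : Prop := ∀ i, y i < 0 → 1 / (n : ℝ) ≤ p i

/-- The step favours the lower half of the bins. -/
def FavoursLowerHalf {n : ℕ} (β : ℝ) (y p w : Fin n → ℝ) : Prop :=
  ∀ φ : Fin n → ℝ, (∀ i, 0 ≤ φ i) → (∀ i j, y i ≤ y j → φ j ≤ φ i) →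
    ∀ M : ℝ, (n : ℝ) ≤ 2 * #{i | φ i ≤ M} →
    β / (2 * n) * (∑ i, φ i - n * M) ≤ ∑ i, drift p w i * φ i

/-! ### The quadratic potential and the spread. -/

theorem sum_sq_bump_le (y w : Fin n → ℝ) (hy : ∑ j, y j = 0) (i : Fin n) :
    ∑ j, bump y w i j ^ 2 ≤ ∑ j, y j ^ 2 + (2 * w i * y i + w i ^ 2) := by
  have hn : (n : ℝ) ≠ 0 := by
    have := i.pos
    positivity
  have h : ∀ j, bump y w i j ^ 2 = y j ^ 2 + (if j = i then 2 * w i * y j + w i ^ 2 -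
      2 * w i ^ 2 / n else 0) - 2 * w i / n * y j + w i ^ 2 / n ^ 2 := by
    intro j
    unfold bump
    split_ifs <;> ring
  simp only [h, sum_add_distrib, sum_sub_distrib, ← mul_sum, hy, sum_ite_eq', mem_univ, if_true,
    sum_const, card_univ, Fintype.card_fin, nsmul_eq_mul]
  have : (n : ℝ) * (w i ^ 2 / n ^ 2) = w i ^ 2 / n := by field_simp
  rw [this]
  have : 0 ≤ w i ^ 2 / n := by positivity
  have h2 : 2 * w i ^ 2 / n = w i ^ 2 / n + w i ^ 2 / n := by ring
  linarith

/-- The square root of the quadratic potential, smoothed at scale `A n`. -/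
def radius (A : ℝ) (y : Fin n → ℝ) : ℝ := √((A * n) ^ 2 + ∑ j, y j ^ 2)

theorem radius_sq (A : ℝ) (y : Fin n → ℝ) : radius A y ^ 2 = (A * n) ^ 2 + ∑ j, y j ^ 2 :=
  Real.sq_sqrt (by positivity)

theorem le_radius (A : ℝ) (y : Fin n → ℝ) : A * n ≤ radius A y := by
  apply Real.le_sqrt_of_sq_le
  have : 0 ≤ ∑ j, y j ^ 2 := by positivity
  linarith

theorem abs_le_radius (A : ℝ) (y : Fin n → ℝ) (i : Fin n) : |y i| ≤ radius A y := by
  apply Real.le_sqrt_of_sq_le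
  rw [sq_abs]
  have : y i ^ 2 ≤ ∑ j, y j ^ 2 :=
    single_le_sum (f := fun j => y j ^ 2) (fun j _ => sq_nonneg _) (mem_univ i)
  have : 0 ≤ (A * n) ^ 2 := by positivity
  linarith

theorem radius_le {A : ℝ} (hA : 0 ≤ A) (y : Fin n → ℝ) :
    radius A y ≤ A * n + ∑ j, |y j| := by
  have h0 : 0 ≤ ∑ j, |y j| := by positivity
  apply Real.sqrt_le_iff.2 ⟨by positivity, ?_⟩
  have : ∑ j, y j ^ 2 ≤ (∑ j, |y j|) ^ 2 := by
    calc ∑ j, y j ^ 2 = ∑ j, |y j| ^ 2 := by simp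
      _ ≤ _ := sum_sq_le_sq_sum_of_nonneg (fun j _ => abs_nonneg _)
  nlinarith [mul_nonneg (mul_nonneg hA (Nat.cast_nonneg (α := ℝ) n)) h0]

/-- The spread potential. -/
def spread (σ A : ℝ) (y : Fin n → ℝ) : ℝ := 2 * σ * (radius A y - A * n)

theorem spread_nonneg {σ : ℝ} (hσ : 0 ≤ σ) (A : ℝ) (y : Fin n → ℝ) : 0 ≤ spread σ A y :=
  mul_nonneg (by positivity) (sub_nonneg.2 (le_radius A y))

/-- AM-GM applied to `radius A y` and `A * n`. It bounds the spread by a constant once the squares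
sum to `O(n)`. -/
theorem spread_le {σ A : ℝ} (hσ : 0 ≤ σ) (hA : 0 < A * n) (y : Fin n → ℝ) :
    spread σ A y ≤ σ * (∑ j, y j ^ 2) / (A * n) := by
  rw [le_div_iff₀ hA]
  have h : radius A y * (A * n) ≤ (A * n) ^ 2 + (∑ j, y j ^ 2) / 2 := by
    have := radius_sq A y
    nlinarith [sq_nonneg (radius A y - A * n)]
  unfold spread
  nlinarith

/-- The linearised change of the spread potential. -/
def spreadStep (σ A : ℝ) (y w : Fin n → ℝ) (i : Fin n) : ℝ :=
  σ / radius A y * (2 * w i * y i + w i ^ 2)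

/-- The square root is concave: `2 R (R' - R) ≤ R' ^ 2 - R ^ 2`. -/
theorem spread_bump_le {σ A : ℝ} (hσ : 0 ≤ σ) (hA : 0 < A * n) (y w : Fin n → ℝ)
    (hy : ∑ j, y j = 0) (i : Fin n) :
    spread σ A (bump y w i) ≤ spread σ A y + spreadStep σ A y w i := by
  have hR : 0 < radius A y := hA.trans_le (le_radius A y)
  have h1 := sum_sq_bump_le y w hy i
  have h2 := radius_sq A y
  have h3 := radius_sq A (bump y w i)
  have h4 : 2 * (radius A (bump y w i) - radius A y) ≤
      (2 * w i * y i + w i ^ 2) / radius A y := by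
    rw [le_div_iff₀ hR]
    nlinarith [sq_nonneg (radius A (bump y w i) - radius A y)]
  have h5 := mul_le_mul_of_nonneg_left h4 hσ
  unfold spread spreadStep
  have h6 : σ / radius A y * (2 * w i * y i + w i ^ 2) =
    σ * ((2 * w i * y i + w i ^ 2) / radius A y) := by ring
  rw [h6]
  linarith

namespace BiasedStep

variable {β : ℝ} {y p w : Fin n → ℝ}

theorem sum_mul_w_le (h : BiasedStep β y p w) : ∑ i, p i * w i ≤ 2 := by
  calc ∑ i, p i * w i ≤ ∑ i, p i * 2 :=
        sum_le_sum fun i _ => mul_le_mul_of_nonneg_left (h.w_le_two i) (h.p_nonneg i)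
    _ = 2 := by rw [← sum_mul, h.p_sum, one_mul]

theorem one_le_sum_mul_w (h : BiasedStep β y p w) : 1 ≤ ∑ i, p i * w i := by
  calc 1 = ∑ i, p i * 1 := by simp [h.p_sum]
    _ ≤ ∑ i, p i * w i :=
        sum_le_sum fun i _ => mul_le_mul_of_nonneg_left (h.one_le_w i) (h.p_nonneg i)

theorem underFrac_add_overFrac (hn : 0 < n) (y : Fin n → ℝ) : underFrac y + overFrac y = 1 := by
  have h : #{j | y j < 0} + #{j | ¬ y j < 0} = n := by
    simpa using card_filter_add_card_filter_not (s := (univ : Finset (Fin n))) (fun j => y j < 0)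
  simp only [not_lt] at h
  have hn' : (n : ℝ) ≠ 0 := by positivity
  unfold underFrac overFrac
  rw [← add_div, div_eq_one_iff_eq hn']
  exact_mod_cast h

theorem underFrac_nonneg (y : Fin n → ℝ) : 0 ≤ underFrac y := by unfold underFrac; positivity
theorem overFrac_nonneg (y : Fin n → ℝ) : 0 ≤ overFrac y := by unfold overFrac; positivity

/-- The drift of the quadratic potential does not depend on the fraction of underloaded bins. -/
theorem sum_drift_mul_le (h : BiasedStep β y p w) (hn : 0 < n) (hy : ∑ j, y j = 0) :
    ∑ i, drift p w i * y i ≤ -(β * (∑ j, |y j|) / (2 * n)) := by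
  -- The positive and negative parts of `y` have the same sum, half of `∑ |y j|`, so the two rates
  -- add up and `underFrac + overFrac = 1` removes the fractions.
  have ho := h.drift_over (fun i => max (y i) 0) (fun i => le_max_right _ _)
    (fun i hi => max_eq_right hi.le) (fun i j hij => max_le_max_right 0 hij)
  have hu := h.drift_under (fun i => max (-y i) 0) (fun i => le_max_right _ _)
    (fun i hi => max_eq_right (by linarith)) (fun i j hij => max_le_max_right 0 (by linarith))
  have e1 : ∑ i, max (y i) 0 = (∑ j, |y j|) / 2 := by
    have : ∀ i, max (y i) 0 = (y i + |y i|) / 2 := by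
      intro i; rcases le_total 0 (y i) with h | h
      · rw [max_eq_left h, abs_of_nonneg h]; ring
      · rw [max_eq_right h, abs_of_nonpos h]; ring
    simp only [this, ← sum_div, sum_add_distrib, hy, zero_add]
  have e2 : ∑ i, max (-y i) 0 = (∑ j, |y j|) / 2 := by
    have : ∀ i, max (-y i) 0 = (-y i + |y i|) / 2 := by
      intro i; rcases le_total 0 (y i) with h | h
      · rw [max_eq_right (by linarith), abs_of_nonneg h]; ring
      · rw [max_eq_left (by linarith), abs_of_nonpos h]; ring
    simp only [this, ← sum_div, sum_add_distrib, sum_neg_distrib, hy, neg_zero, zero_add]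
  have e3 : ∑ i, drift p w i * y i =
      ∑ i, drift p w i * max (y i) 0 - ∑ i, drift p w i * max (-y i) 0 := by
    rw [← sum_sub_distrib]
    refine sum_congr rfl fun i _ => ?_
    rw [← mul_sub, max_zero_sub_eq_self]
  rw [e1] at ho
  rw [e2] at hu
  rw [e3]
  have hs := underFrac_add_overFrac hn y
  have : β * (∑ j, |y j|) / (2 * n) = β * underFrac y / n * ((∑ j, |y j|) / 2) +
      β * overFrac y / n * ((∑ j, |y j|) / 2) := by
    rw [← eq_sub_iff_add_eq'] at hs
    rw [hs]; field_simp; ring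
  linarith

/-- Bounded increments are the reason for the square root: the quadratic potential itself changes by
an amount proportional to the deviation and could not be exponentiated. -/
theorem abs_spreadStep_le (h : BiasedStep β y p w) {σ A : ℝ} (hσ : 0 ≤ σ) (hA : 1 ≤ A)
    (hn : 0 < n) (i : Fin n) : |spreadStep σ A y w i| ≤ 8 * σ := by
  have hn1 : (1 : ℝ) ≤ n := by exact_mod_cast hn
  have hR1 : 1 ≤ radius A y := le_trans (by nlinarith) (le_radius A y)
  have hR : 0 < radius A y := by linarith
  have h1 := abs_le_radius A y i
  have hw := h.one_le_w i
  have hw2 := h.w_le_two i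
  have h2 : |2 * w i * y i + w i ^ 2| ≤ 8 * radius A y := by
    calc |2 * w i * y i + w i ^ 2| ≤ |2 * w i * y i| + |w i ^ 2| := abs_add_le _ _
      _ = 2 * w i * |y i| + w i ^ 2 := by
          rw [abs_mul, abs_of_nonneg (by linarith : 0 ≤ 2 * w i), abs_of_nonneg (sq_nonneg (w i))]
      _ ≤ 2 * 2 * radius A y + 2 ^ 2 := by gcongr
      _ ≤ 8 * radius A y := by linarith
  unfold spreadStep
  rw [abs_mul, abs_of_nonneg (by positivity : 0 ≤ σ / radius A y)]
  calc σ / radius A y * |2 * w i * y i + w i ^ 2| ≤ σ / radius A y * (8 * radius A y) := by gcongr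
    _ = 8 * σ := by field_simp

/-- As `p i ≤ 2 / n`, the mean of `y i ^ 2` under `p` is at most `2 / n` times the squared radius;
the constant part is absorbed by `radius A y ≥ n`. -/
theorem sum_spreadStep_sq_le (h : BiasedStep β y p w) {σ A : ℝ} (hA : 1 ≤ A)
    (hn : 0 < n) : ∑ i, p i * spreadStep σ A y w i ^ 2 ≤ 96 * σ ^ 2 / n := by
  have hn1 : (1 : ℝ) ≤ n := by exact_mod_cast hn
  have hR1 : n ≤ radius A y := le_trans (by nlinarith) (le_radius A y)
  have hR : 0 < radius A y := by linarith
  have h1 : ∀ i, p i * spreadStep σ A y w i ^ 2 ≤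
      σ ^ 2 / radius A y ^ 2 * (64 / n * y i ^ 2 + 32 * p i) := by
    intro i
    have hw := h.one_le_w i
    have hw2 := h.w_le_two i
    have h2 : (2 * w i * y i + w i ^ 2) ^ 2 ≤ 32 * y i ^ 2 + 32 := by
      have h3 : (2 * w i * y i + w i ^ 2) ^ 2 ≤ 2 * (2 * w i * y i) ^ 2 + 2 * (w i ^ 2) ^ 2 := by
        nlinarith [sq_nonneg (2 * w i * y i - w i ^ 2)]
      have h4 : w i ^ 2 ≤ 4 := by nlinarith
      have h5 : (w i ^ 2) ^ 2 ≤ 16 := by nlinarith [sq_nonneg (w i)]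
      have h6 : w i ^ 2 * y i ^ 2 ≤ 4 * y i ^ 2 := by gcongr
      nlinarith
    have h7 : p i * y i ^ 2 ≤ 2 / n * y i ^ 2 := by gcongr; exact h.p_le i
    unfold spreadStep
    rw [mul_pow, div_pow]
    calc p i * (σ ^ 2 / radius A y ^ 2 * (2 * w i * y i + w i ^ 2) ^ 2)
        ≤ p i * (σ ^ 2 / radius A y ^ 2 * (32 * y i ^ 2 + 32)) := by
          gcongr
          exact h.p_nonneg i
      _ = σ ^ 2 / radius A y ^ 2 * (32 * (p i * y i ^ 2) + 32 * p i) := by ring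
      _ ≤ σ ^ 2 / radius A y ^ 2 * (32 * (2 / n * y i ^ 2) + 32 * p i) := by gcongr
      _ = _ := by ring
  refine (sum_le_sum fun i _ => h1 i).trans ?_
  rw [← mul_sum, sum_add_distrib, ← mul_sum, ← mul_sum, h.p_sum]
  have h8 : ∑ j, y j ^ 2 ≤ radius A y ^ 2 := by
    rw [radius_sq]; nlinarith [sq_nonneg (A * n)]
  have h9 : 32 * 1 ≤ 32 / (n : ℝ) * radius A y ^ 2 := by
    rw [div_mul_eq_mul_div, le_div_iff₀ (by linarith)]
    nlinarith
  calc σ ^ 2 / radius A y ^ 2 * (64 / n * ∑ j, y j ^ 2 + 32 * 1)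
      ≤ σ ^ 2 / radius A y ^ 2 * (64 / n * radius A y ^ 2 + 32 / n * radius A y ^ 2) := by gcongr
    _ = 96 * σ ^ 2 / n := by field_simp; ring

theorem sum_spreadStep_le (h : BiasedStep β y p w) {σ A : ℝ} (hσ : 0 ≤ σ) (hn : 0 < n)
    (hy : ∑ j, y j = 0) :
    ∑ i, p i * spreadStep σ A y w i ≤ σ / radius A y * (4 - β * (∑ j, |y j|) / n) := by
  have h1 : ∑ i, p i * spreadStep σ A y w i =
      σ / radius A y * (2 * ∑ i, drift p w i * y i + ∑ i, p i * w i ^ 2) := by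
    have : ∑ i, drift p w i * y i = ∑ i, p i * w i * y i := by
      simp only [drift, sub_mul, sum_sub_distrib, ← mul_sum, hy]; ring
    rw [this, mul_sum, ← sum_add_distrib, mul_sum]
    refine sum_congr rfl fun i _ => ?_
    unfold spreadStep; ring
  have h2 : ∑ i, p i * w i ^ 2 ≤ 4 := by
    calc ∑ i, p i * w i ^ 2 ≤ ∑ i, p i * 4 := by
          refine sum_le_sum fun i _ => mul_le_mul_of_nonneg_left ?_ (h.p_nonneg i)
          nlinarith [h.one_le_w i, h.w_le_two i]
      _ = 4 := by rw [← sum_mul, h.p_sum, one_mul]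
  have h3 := h.sum_drift_mul_le hn hy
  rw [h1]
  have hR : 0 ≤ radius A y := Real.sqrt_nonneg _
  refine mul_le_mul_of_nonneg_left ?_ (by positivity)
  have : β * (∑ j, |y j|) / n = 2 * (β * (∑ j, |y j|) / (2 * n)) := by field_simp
  linarith

/-- With `A = 64 / β` the spread potential grows slowly. -/
theorem sum_spreadStep_le_always (h : BiasedStep β y p w) {σ : ℝ} (hβ : 0 < β) (hσ : 0 ≤ σ)
    (hn : 0 < n) (hy : ∑ j, y j = 0) :
    ∑ i, p i * spreadStep σ (64 / β) y w i ≤ σ * β / 16 / n := by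
  have hn0 : (0 : ℝ) < n := by exact_mod_cast hn
  refine (h.sum_spreadStep_le hσ hn hy).trans ?_
  have hR : 64 / β * n ≤ radius (64 / β) y := le_radius _ y
  have h0 : 0 ≤ β * (∑ j, |y j|) / n := by positivity
  calc σ / radius (64 / β) y * (4 - β * (∑ j, |y j|) / n)
      ≤ σ / radius (64 / β) y * 4 := by
        refine mul_le_mul_of_nonneg_left (by linarith) ?_
        have : 0 ≤ radius (64 / β) y := Real.sqrt_nonneg _
        positivity
    _ ≤ σ / (64 / β * n) * 4 := by gcongr
    _ = σ * β / 16 / n := by field_simp; ring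

/-- With `A = 64 / β` the spread potential drops when the deviations are large. -/
theorem sum_spreadStep_le_of_large (h : BiasedStep β y p w) {σ : ℝ} (hβ : 0 < β)
    (hσ : 0 ≤ σ) (hn : 0 < n) (hy : ∑ j, y j = 0) (hl : 64 / β * n ≤ ∑ j, |y j|) :
    ∑ i, p i * spreadStep σ (64 / β) y w i ≤ -(4 * (σ * β / 16) / n) := by
  have hn0 : (0 : ℝ) < n := by exact_mod_cast hn
  refine (h.sum_spreadStep_le hσ hn hy).trans ?_
  set D := ∑ j, |y j| with hD
  have hD0 : 0 < D := lt_of_lt_of_le (by positivity) hl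
  have hR0 : 0 < radius (64 / β) y :=
    lt_of_lt_of_le (by positivity) (le_radius _ y)
  -- With radius at most `2 D` and `β D ≥ 64 n`, the drop is `σ β / (4 n)`, four times the worst
  -- growth in `sum_spreadStep_le_always`.
  have hR : radius (64 / β) y ≤ 2 * D := by
    have := radius_le (by positivity : 0 ≤ 64 / β) y
    linarith
  have h64 : 64 ≤ β * D / n := by
    rw [le_div_iff₀ hn0]
    calc 64 * (n : ℝ) = β * (64 / β * n) := by field_simp
      _ ≤ β * D := by gcongr
  have h1 : 4 - β * D / n ≤ -(β * D / (2 * n)) := by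
    have : β * D / n = 2 * (β * D / (2 * n)) := by field_simp
    linarith
  calc σ / radius (64 / β) y * (4 - β * D / n)
      ≤ σ / radius (64 / β) y * -(β * D / (2 * n)) := by gcongr
    _ = -(σ / radius (64 / β) y * (β * D / (2 * n))) := by ring
    _ ≤ -(σ / (2 * D) * (β * D / (2 * n))) := by gcongr
    _ = _ := by field_simp; ring

end BiasedStep

/-! ### The bounded function `tau` and its drift. -/

/-- An increasing bounded function that is concave on `[-1, ∞)`. -/
def tau (u : ℝ) : ℝ := -Real.exp (-4 * max u (-1))

theorem tau_nonpos (u : ℝ) : tau u ≤ 0 := neg_nonpos.2 (Real.exp_pos _).le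

theorem neg_exp_four_le_tau (u : ℝ) : -Real.exp 4 ≤ tau u := by
  exact neg_le_neg (Real.exp_le_exp.2 (by linarith [le_max_right u (-1)]))

theorem tau_mono : Monotone tau := fun u v h => by
  have := max_le_max_right (-1 : ℝ) h
  exact neg_le_neg (Real.exp_le_exp.2 (by linarith))

theorem tau_of_le {u : ℝ} (h : -1 ≤ u) : tau u = -Real.exp (-4 * u) := by
  rw [tau, max_eq_left h]

theorem tau_sub_tau_le {u v : ℝ} (h : u ≤ v) : tau v - tau u ≤ 4 * Real.exp 4 * (v - u) := by
  have h1 := max_le_max_right (-1 : ℝ) h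
  have h2 := le_max_right u (-1)
  have h3 : max v (-1) - max u (-1) ≤ v - u := by
    rcases le_total v (-1) with hv | hv
    · rw [max_eq_right hv]; linarith
    · rw [max_eq_left hv]; linarith [le_max_left u (-1)]
  unfold tau
  set a := max u (-1)
  set b := max v (-1)
  have h4 : -4 * b = -4 * a + -4 * (b - a) := by ring
  have h5 := Real.add_one_le_exp (-4 * (b - a))
  have h6 : Real.exp (-4 * a) ≤ Real.exp 4 := Real.exp_le_exp.2 (by linarith)
  rw [h4, Real.exp_add]
  nlinarith [Real.exp_pos (-4 * a)]

theorem abs_tau_sub_tau_le (u v : ℝ) : |tau v - tau u| ≤ 4 * Real.exp 4 * |v - u| := by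
  rcases le_total u v with h | h
  · rw [abs_of_nonneg (sub_nonneg.2 (tau_mono h)), abs_of_nonneg (sub_nonneg.2 h)]
    exact tau_sub_tau_le h
  · rw [abs_sub_comm, abs_sub_comm v, abs_of_nonneg (sub_nonneg.2 (tau_mono h)),
      abs_of_nonneg (sub_nonneg.2 h)]
    exact tau_sub_tau_le h

theorem sum_abs_bump_sub_le {w : Fin n → ℝ} (y : Fin n → ℝ) (i : Fin n) (hw : 0 ≤ w i) :
    ∑ j, |bump y w i j - y j| ≤ 2 * w i := by
  have hn : (n : ℝ) ≠ 0 := by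
    have := i.pos
    positivity
  calc ∑ j, |bump y w i j - y j| ≤ ∑ j, ((if j = i then w i else 0) + w i / n) := by
        refine sum_le_sum fun j _ => ?_
        have : 0 ≤ w i / n := by positivity
        unfold bump
        rw [add_sub_cancel_left, mul_sub, abs_le]
        split_ifs <;> constructor <;> ring_nf at * <;> linarith
    _ = 2 * w i := by
        rw [sum_add_distrib]
        simp
        field_simp; ring

/-- The rescaled change of the sum of `tau (s * y j)`, where `s = 1` or `s = -1`. -/
def tauStep (s : ℝ) (y w : Fin n → ℝ) (i : Fin n) : ℝ :=
  (∑ j, (tau (s * bump y w i j) - tau (s * y j))) / n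

namespace BiasedStep

variable {β : ℝ} {y p w : Fin n → ℝ}

theorem abs_tauStep_le (h : BiasedStep β y p w) {s : ℝ} (hs : |s| = 1) (i : Fin n) :
    |tauStep s y w i| ≤ 16 * Real.exp 4 / n := by
  unfold tauStep
  rw [abs_div, Nat.abs_cast]
  gcongr
  have hw1 := h.one_le_w i
  have hw2 := h.w_le_two i
  calc |∑ j, (tau (s * bump y w i j) - tau (s * y j))|
      ≤ ∑ j, |tau (s * bump y w i j) - tau (s * y j)| := abs_sum_le_sum_abs _ _
    _ ≤ ∑ j, 4 * Real.exp 4 * |bump y w i j - y j| := by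
        refine sum_le_sum fun j _ => (abs_tau_sub_tau_le _ _).trans_eq ?_
        rw [← mul_sub, abs_mul, hs, one_mul]
    _ ≤ 4 * Real.exp 4 * 4 := by
        rw [← mul_sum]
        have := sum_abs_bump_sub_le y i (by linarith : 0 ≤ w i)
        gcongr
        linarith
    _ = 16 * Real.exp 4 := by ring

/-- Splitting off the event that bin `j` itself is chosen. -/
theorem sum_bump_le (h : BiasedStep β y p w) (g : ℝ → ℝ) (j : Fin n) {a c : ℝ}
    (ha : g (y j + w j * (1 - 1 / n)) ≤ a) (hc : ∀ i, g (y j - w i / n) ≤ c) :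
    ∑ i, p i * g (bump y w i j) ≤ p j * a + (1 - p j) * c := by
  have h1 : 1 - p j = ∑ i ∈ univ.erase j, p i := by
    rw [← h.p_sum, ← add_sum_erase _ _ (mem_univ j)]; ring
  rw [h1, sum_mul, ← add_sum_erase _ _ (mem_univ j)]
  refine add_le_add ?_ (sum_le_sum fun i hi => ?_)
  · refine mul_le_mul_of_nonneg_left ?_ (h.p_nonneg j)
    simpa [bump] using ha
  · refine mul_le_mul_of_nonneg_left ?_ (h.p_nonneg i)
    have hij : j ≠ i := fun e => (mem_erase.1 hi).1 e.symm
    have e : y j + w i * (0 - 1 / n) = y j - w i / n := by ring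
    simp only [bump, hij, if_false, e]
    exact hc i

/-- With `E = exp (-4 * y j)`, an overloaded bin is chosen with probability at most `2 / n`, and
then `tau` rises by at most `E` because `tau ≤ 0`. Otherwise its deviation falls by at least `1 /
n`, which costs at least `4 E / n`; this has probability at least `3 / 4`. The balance is `2 E / n -
3 E / n`. -/
theorem sum_tau_over (h : BiasedStep β y p w) (hn : 8 ≤ n) (j : Fin n) :
    ∑ i, p i * (tau (1 * bump y w i j) - tau (1 * y j)) ≤
      if 0 ≤ y j then -(Real.exp (-4 * |y j|) / n) else 16 * Real.exp 4 / n := by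
  have hn0 : (8 : ℝ) ≤ n := by exact_mod_cast hn
  have hn1 : (0 : ℝ) < n := by linarith
  have hpj := h.p_le j
  have hpj0 := h.p_nonneg j
  have hinv : 2 / (n : ℝ) ≤ 1 / 4 := by rw [div_le_div_iff₀] <;> linarith
  split_ifs with hy
  · rw [abs_of_nonneg hy]
    set E := Real.exp (-4 * y j) with hE
    have hE0 : 0 < E := Real.exp_pos _
    have hτ : tau (y j) = -E := tau_of_le (by linarith)
    refine (h.sum_bump_le (fun u => tau (1 * u) - tau (1 * y j)) j (a := E)
      (c := -(4 / n * E)) ?_ fun i => ?_).trans ?_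
    · simp only [one_mul]
      rw [hτ]
      linarith [tau_nonpos (y j + w j * (1 - 1 / n))]
    · have hw := h.one_le_w i
      have hw2 := h.w_le_two i
      have h1 : w i / n ≤ 1 := by rw [div_le_one hn1]; linarith
      simp only [one_mul]
      rw [hτ, tau_of_le (by linarith)]
      have : -4 * (y j - w i / n) = -4 * y j + 4 * (w i / n) := by ring
      rw [this, Real.exp_add, ← hE]
      have h2 := Real.add_one_le_exp (4 * (w i / n))
      have h3 : 1 / n ≤ w i / n := by gcongr
      have h4 : (4 : ℝ) / n = 4 * (1 / n) := by ring
      rw [h4]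
      nlinarith
    · have h5 : (1 - p j) * (4 / n) ≥ 3 / n := by
        have : (3 : ℝ) / n = (1 - 1 / 4) * (4 / n) := by ring
        rw [this]
        gcongr
        linarith
      have h6 : p j ≤ 2 / n := hpj
      have h7 : (3 : ℝ) / n = 2 / n + 1 / n := by ring
      have h8 : E / n = E * (1 / n) := by ring
      rw [h8]
      nlinarith
  · refine (h.sum_bump_le (fun u => tau (1 * u) - tau (1 * y j)) j (a := Real.exp 4)
      (c := 0) ?_ fun i => ?_).trans ?_
    · simp only [one_mul]
      linarith [tau_nonpos (y j + w j * (1 - 1 / n)), neg_exp_four_le_tau (y j)]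
    · have hw := h.one_le_w i
      have h0 : 0 ≤ w i / n := by positivity
      simp only [one_mul]
      exact sub_nonpos.2 (tau_mono (by linarith))
    · rw [mul_zero, add_zero]
      calc p j * Real.exp 4 ≤ 2 / n * Real.exp 4 := by gcongr
        _ = 2 * Real.exp 4 / n := by ring
        _ ≤ _ := by gcongr; norm_num

/-- With `E = exp (4 * y j)`, an underloaded bin is chosen with probability at least `1 / n`. Its
deviation then rises by at least `3 / 4`, which multiplies `E` by at least `exp 3 ≥ 10`, a drop of
`9 E`. Otherwise the deviation falls by at most `2 / n`, a gain of at most `8 E / n`. The exponent 4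
in `tau` makes the drop win. -/
theorem sum_tau_under (h : BiasedStep β y p w) (hp : SamplesUnderloaded y p) (hn : 8 ≤ n)
    (j : Fin n) :
    ∑ i, p i * (tau (-1 * bump y w i j) - tau (-1 * y j)) ≤
      if y j < 0 then -(Real.exp (-4 * |y j|) / n) else 16 * Real.exp 4 / n := by
  have hn0 : (8 : ℝ) ≤ n := by exact_mod_cast hn
  have hn1 : (0 : ℝ) < n := by linarith
  have hpj := h.p_le j
  have hpj0 := h.p_nonneg j
  have hinv : 1 / (n : ℝ) ≤ 1 / 8 := by rw [div_le_div_iff₀] <;> linarith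
  have hwj := h.one_le_w j
  have hwj2 : 3 / 4 ≤ w j * (1 - 1 / n) := by nlinarith
  have hpj1 : 0 ≤ 1 - p j := by
    have : (2 : ℝ) / n = 2 * (1 / n) := by ring
    linarith
  split_ifs with hy
  · have hps := hp j hy
    rw [abs_of_neg hy]
    set E := Real.exp (-4 * -y j) with hE
    have hE0 : 0 < E := Real.exp_pos _
    have hτ : tau (-1 * y j) = -E := by rw [tau_of_le (by linarith), hE]; ring_nf
    have he3 : (10 : ℝ) ≤ Real.exp 3 := by
      have h1 := Real.exp_one_gt_d9
      have : Real.exp 3 = Real.exp 1 ^ 3 := by rw [← Real.exp_nat_mul]; norm_num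
      rw [this]
      have : (2.7 : ℝ) ^ 3 ≤ Real.exp 1 ^ 3 := by gcongr; linarith
      norm_num at this
      linarith
    refine (h.sum_bump_le (fun u => tau (-1 * u) - tau (-1 * y j)) j (a := -(9 * E))
      (c := 8 / n * E) ?_ fun i => ?_).trans ?_
    · have h1 : tau (-1 * (y j + w j * (1 - 1 / n))) ≤ tau (-y j - 3 / 4) :=
        tau_mono (by linarith)
      have h2 : tau (-y j - 3 / 4) = -(E * Real.exp 3) := by
        rw [tau_of_le (by linarith), hE, ← Real.exp_add]; ring_nf
      rw [hτ]
      nlinarith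
    · have hw := h.one_le_w i
      have hw2 := h.w_le_two i
      have h0 : 0 ≤ w i / n := by positivity
      rw [hτ, tau_of_le (by linarith)]
      have : -4 * (-1 * (y j - w i / n)) = -4 * -y j + -4 * (w i / n) := by ring
      rw [this, Real.exp_add, ← hE]
      have h2 := Real.add_one_le_exp (-4 * (w i / n))
      have h3 : w i / n ≤ 2 / n := by gcongr
      have h4 : (8 : ℝ) / n = 4 * (2 / n) := by ring
      rw [h4]
      nlinarith
    · have h5 : (1 - p j) * (8 / n * E) ≤ 8 / n * E := by
        have : 0 ≤ 8 / n * E := by positivity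
        nlinarith
      have h7 : (8 : ℝ) / n = 8 * (1 / n) := by ring
      have h8 : E / n = E * (1 / n) := by ring
      rw [h8]
      rw [h7] at h5 ⊢
      nlinarith
  · refine (h.sum_bump_le (fun u => tau (-1 * u) - tau (-1 * y j)) j (a := 0)
      (c := 16 * Real.exp 4 / n) ?_ fun i => ?_).trans ?_
    · exact sub_nonpos.2 (tau_mono (by linarith))
    · have hw := h.one_le_w i
      have hw2 := h.w_le_two i
      have h0 : 0 ≤ w i / n := by positivity
      refine (tau_sub_tau_le (by linarith)).trans ?_
      have h1 : -1 * (y j - w i / n) - -1 * y j = w i / n := by ring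
      rw [h1, ← mul_div_assoc]
      have h2 : 4 * Real.exp 4 * w i ≤ 16 * Real.exp 4 := by nlinarith [Real.exp_pos 4]
      gcongr
    · have : 0 ≤ 16 * Real.exp 4 / n := by positivity
      nlinarith

end BiasedStep

/-- At most half of the bins deviate by more than twice the average. -/
theorem card_large_le (y : Fin n → ℝ) {C : ℝ} (hC : 0 < C) (hy : ∑ j, |y j| ≤ C * n) :
    (#{j | 2 * C < |y j|} : ℝ) ≤ n / 2 := by
  have : (#{j | 2 * C < |y j|} : ℝ) * (2 * C) ≤ C * n := by
    calc (#{j | 2 * C < |y j|} : ℝ) * (2 * C) = ∑ j with 2 * C < |y j|, 2 * C := by simp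
      _ ≤ ∑ j with 2 * C < |y j|, |y j| :=
          sum_le_sum fun j hj => (mem_filter.1 hj).2.le
      _ ≤ ∑ j, |y j| := sum_le_sum_of_subset_of_nonneg (filter_subset _ _)
          fun j _ _ => abs_nonneg _
      _ ≤ _ := hy
  nlinarith

/-- If `y` is small on average, then a function that is `-exp (-4 |y j|)` on most bins has a
negative sum. -/
theorem sum_ite_neg_exp_le (y : Fin n → ℝ) (P : Fin n → Prop) [DecidablePred P] {K : ℝ} (hn : 0 < n)
    {e C : ℝ} (he : (#{j | ¬ P j} : ℝ) ≤ e * n) (he4 : e ≤ 1 / 4) (hK : 0 ≤ K)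
    (hC : 0 < C) (hy : ∑ j, |y j| ≤ C * n) :
    ∑ j, (if P j then -(Real.exp (-4 * |y j|) / n) else K / n) ≤
      -(Real.exp (-8 * C) / 4) + K * e := by
  have hn0 : (0 : ℝ) < n := by exact_mod_cast hn
  rw [sum_ite, sum_const, nsmul_eq_mul]
  have h1 : (#{j | ¬ P j} : ℝ) * (K / n) ≤ K * e := by
    calc (#{j | ¬ P j} : ℝ) * (K / n) ≤ e * n * (K / n) := by gcongr
      _ = K * e := by field_simp
  have hlarge := card_large_le y hC hy
  have hcover : (n : ℝ) ≤ #{j | P j ∧ |y j| ≤ 2 * C} + #{j | ¬ P j} + #{j | 2 * C < |y j|} := by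
    have : (univ : Finset (Fin n)) ⊆ ((univ.filter fun j => P j ∧ |y j| ≤ 2 * C) ∪
        univ.filter fun j => ¬ P j) ∪ univ.filter fun j => 2 * C < |y j| := by
      intro j _
      simp only [mem_union, mem_filter, mem_univ, true_and]
      by_cases hP : P j <;> rcases le_or_gt |y j| (2 * C) with h | h <;> tauto
    have h2 := (card_le_card this).trans
      ((card_union_le _ _).trans (add_le_add_left (card_union_le _ _) _))
    rw [card_univ, Fintype.card_fin] at h2
    exact_mod_cast h2
  -- At most a quarter of the bins violates `P` and at most half deviates by more than `2 * C`.
  have hgood : (n : ℝ) / 4 ≤ #{j | P j ∧ |y j| ≤ 2 * C} := by nlinarith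
  have h3 : ∑ j with P j, -(Real.exp (-4 * |y j|) / n) ≤ -(Real.exp (-8 * C) / 4) := by
    rw [sum_neg_distrib]
    apply neg_le_neg
    calc Real.exp (-8 * C) / 4 = n / 4 * (Real.exp (-8 * C) / n) := by field_simp
      _ ≤ #{j | P j ∧ |y j| ≤ 2 * C} * (Real.exp (-8 * C) / n) := by gcongr
      _ = ∑ j with P j ∧ |y j| ≤ 2 * C, Real.exp (-8 * C) / n := by simp
      _ ≤ ∑ j with P j ∧ |y j| ≤ 2 * C, Real.exp (-4 * |y j|) / n := by
          refine sum_le_sum fun j hj => ?_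
          have := (mem_filter.1 hj).2.2
          have h4 := Real.exp_le_exp.2 (by linarith : -8 * C ≤ -4 * |y j|)
          gcongr
      _ ≤ _ := by
          refine sum_le_sum_of_subset_of_nonneg (fun j hj => ?_) fun j _ _ => by positivity
          simp only [mem_filter, mem_univ, true_and] at hj ⊢
          exact hj.1
  linarith

theorem sum_ite_neg_exp_le_card (y : Fin n → ℝ) (P : Fin n → Prop) [DecidablePred P] {K : ℝ} :
    ∑ j, (if P j then -(Real.exp (-4 * |y j|) / n) else K / n) ≤ K * (#{j | ¬ P j} / n) := by
  rw [sum_ite, sum_const, nsmul_eq_mul]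
  have : ∑ j with P j, -(Real.exp (-4 * |y j|) / n) ≤ 0 :=
    sum_nonpos fun j _ => neg_nonpos.2 (by positivity)
  have h2 : (#{j | ¬ P j} : ℝ) * (K / n) = K * (#{j | ¬ P j} / n) := by ring
  linarith

/-! ### Expected change of the exponential potentials. -/

/-- The exponential potential. -/
def expPot (a : ℝ) (y : Fin n → ℝ) : ℝ := ∑ j, Real.exp (a * y j)

theorem expPot_nonneg (a : ℝ) (y : Fin n → ℝ) : 0 ≤ expPot a y :=
  sum_nonneg fun _ _ => (Real.exp_pos _).le

namespace BiasedStep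

variable {β : ℝ} {y p w : Fin n → ℝ}

theorem sum_bump_sub (y p w : Fin n → ℝ) (j : Fin n) :
    ∑ i, p i * (bump y w i j - y j) = drift p w j := by
  have : ∀ i, p i * (bump y w i j - y j) = (if j = i then p i * w i else 0) - p i * w i / n := by
    intro i
    unfold bump
    split_ifs <;> ring
  simp only [this, sum_sub_distrib, sum_ite_eq, mem_univ, if_true, ← sum_div]
  rfl

theorem sum_bump_sub_sq_le (h : BiasedStep β y p w) (j : Fin n) :
    ∑ i, p i * (bump y w i j - y j) ^ 2 ≤ 12 / n := by
  have hn1 : (1 : ℝ) ≤ n := by exact_mod_cast j.pos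
  have hinv : 1 / (n : ℝ) ≤ 1 := by rw [div_le_one (by linarith)]; exact hn1
  have hinv0 : 0 < 1 / (n : ℝ) := by positivity
  have h1 : ∀ i, p i * (bump y w i j - y j) ^ 2 ≤ (if j = i then 4 * p i else 0) +
      p i * (4 / n) := by
    intro i
    have hp := h.p_nonneg i
    have hw : w i ^ 2 ≤ 4 := by nlinarith [h.one_le_w i, h.w_le_two i]
    have h4 : (4 : ℝ) / n = 4 * (1 / n) := by ring
    unfold bump
    rw [h4]
    have e : (y j + w i * ((if j = i then (1 : ℝ) else 0) - 1 / n) - y j) ^ 2 =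
      w i ^ 2 * ((if j = i then (1 : ℝ) else 0) - 1 / n) ^ 2 := by ring
    rw [e]
    split_ifs with hji
    · calc p i * (w i ^ 2 * (1 - 1 / n) ^ 2) ≤ p i * (4 * 1) := by
            gcongr
            nlinarith
        _ ≤ _ := by nlinarith [mul_nonneg hp hinv0.le]
    · calc p i * (w i ^ 2 * (0 - 1 / n) ^ 2) ≤ p i * (4 * (1 / n)) := by
            gcongr
            nlinarith
        _ = _ := by ring
  refine (sum_le_sum fun i _ => h1 i).trans ?_
  rw [sum_add_distrib, sum_ite_eq, if_pos (mem_univ j), ← sum_mul, h.p_sum]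
  have := h.p_le j
  calc 4 * p j + 1 * (4 / n) ≤ 4 * (2 / n) + 1 * (4 / n) := by gcongr
    _ = 12 / n := by ring

theorem abs_bump_sub_le (h : BiasedStep β y p w) (i j : Fin n) : |bump y w i j - y j| ≤ 2 := by
  have hn1 : (1 : ℝ) ≤ n := by exact_mod_cast j.pos
  have hinv : 1 / (n : ℝ) ≤ 1 := by rw [div_le_one (by linarith)]; exact hn1
  have hinv0 : 0 < 1 / (n : ℝ) := by positivity
  have h1 := h.one_le_w i
  have h2 := h.w_le_two i
  unfold bump
  rw [add_sub_cancel_left, abs_mul, abs_of_pos (by linarith : 0 < w i)]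
  have : |(if j = i then (1 : ℝ) else 0) - 1 / n| ≤ 1 := by
    rw [abs_le]
    split_ifs <;> constructor <;> linarith
  calc w i * |(if j = i then (1 : ℝ) else 0) - 1 / n| ≤ 2 * 1 := by gcongr
    _ = 2 := by ring

/-- Second-order expansion of the expected exponential potential, weighted with `exp (r i)`. -/
theorem sum_exp_mul_expPot_le (h : BiasedStep β y p w) {a ρ : ℝ} (ha : |a| ≤ 1 / 4)
    {r : Fin n → ℝ} (hr : ∀ i, |r i| ≤ 1 / 2) (hρ : ∑ i, p i * r i ^ 2 ≤ ρ) :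
    ∑ i, p i * (Real.exp (r i) * expPot a (bump y w i)) ≤
      expPot a y * (1 + ∑ i, p i * r i + 2 * (12 * a ^ 2 / n + ρ)) +
        a * ∑ j, drift p w j * Real.exp (a * y j) := by
  have hexp : ∀ i j, Real.exp (r i) * Real.exp (a * bump y w i j) ≤ Real.exp (a * y j) *
      (1 + r i + a * (bump y w i j - y j) + 2 * r i ^ 2 +
        2 * a ^ 2 * (bump y w i j - y j) ^ 2) := by
    intro i j
    set v := bump y w i j - y j with hv
    have e : Real.exp (r i) * Real.exp (a * bump y w i j) =
        Real.exp (a * y j) * Real.exp (r i + a * v) := by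
      rw [← Real.exp_add, ← Real.exp_add]; congr 1; rw [hv]; ring
    rw [e]
    refine mul_le_mul_of_nonneg_left ?_ (Real.exp_pos _).le
    have hav : |a * v| ≤ 1 / 2 := by
      rw [abs_mul]
      calc |a| * |v| ≤ 1 / 4 * 2 := by
            gcongr
            exact h.abs_bump_sub_le i j
        _ = 1 / 2 := by norm_num
    have hz : |r i + a * v| ≤ 1 := (abs_add_le _ _).trans (by linarith [hr i])
    -- `exp z ≤ 1 + z + z ^ 2`, then `(r + a v) ^ 2 ≤ 2 r ^ 2 + 2 (a v) ^ 2`, so no correlation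
    -- between the weight and the displacement has to be computed.
    have h1 := (abs_le.1 (Real.abs_exp_sub_one_sub_id_le hz)).2
    nlinarith [sq_nonneg (r i - a * v)]
  have hj : ∀ j, ∑ i, p i * (Real.exp (r i) * Real.exp (a * bump y w i j)) ≤
      Real.exp (a * y j) * (1 + ∑ i, p i * r i + 2 * (12 * a ^ 2 / n + ρ)) +
        a * (drift p w j * Real.exp (a * y j)) := by
    intro j
    have e : ∑ i, p i * (1 + r i + a * (bump y w i j - y j) + 2 * r i ^ 2 +
        2 * a ^ 2 * (bump y w i j - y j) ^ 2) = 1 + ∑ i, p i * r i + a * drift p w j +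
        2 * ∑ i, p i * r i ^ 2 + 2 * a ^ 2 * ∑ i, p i * (bump y w i j - y j) ^ 2 := by
      trans ∑ i, p i + ∑ i, p i * r i + a * drift p w j +
        2 * ∑ i, p i * r i ^ 2 + 2 * a ^ 2 * ∑ i, p i * (bump y w i j - y j) ^ 2
      swap
      · rw [h.p_sum]
      rw [← sum_bump_sub y p w j]
      simp only [mul_sum, ← sum_add_distrib]
      exact sum_congr rfl fun i _ => by ring
    calc ∑ i, p i * (Real.exp (r i) * Real.exp (a * bump y w i j))
        ≤ ∑ i, p i * (Real.exp (a * y j) * (1 + r i + a * (bump y w i j - y j) + 2 * r i ^ 2 +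
          2 * a ^ 2 * (bump y w i j - y j) ^ 2)) :=
          sum_le_sum fun i _ => mul_le_mul_of_nonneg_left (hexp i j) (h.p_nonneg i)
      _ = Real.exp (a * y j) * ∑ i, p i * (1 + r i + a * (bump y w i j - y j) + 2 * r i ^ 2 +
          2 * a ^ 2 * (bump y w i j - y j) ^ 2) := by
          rw [mul_sum]; exact sum_congr rfl fun i _ => by ring
      _ ≤ Real.exp (a * y j) * (1 + ∑ i, p i * r i + a * drift p w j +
        2 * ρ + 2 * a ^ 2 * (12 / n)) := by
          rw [e]
          have := h.sum_bump_sub_sq_le j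
          gcongr
      _ = _ := by ring
  unfold expPot
  calc ∑ i, p i * (Real.exp (r i) * ∑ j, Real.exp (a * bump y w i j))
      = ∑ j, ∑ i, p i * (Real.exp (r i) * Real.exp (a * bump y w i j)) := by
        rw [sum_comm]; simp only [mul_sum]
    _ ≤ _ := sum_le_sum fun j _ => hj j
    _ = _ := by rw [sum_add_distrib, ← sum_mul, ← mul_sum]

theorem drift_le (h : BiasedStep β y p w) (i : Fin n) : drift p w i ≤ p i * w i := by
  have h1 := h.one_le_sum_mul_w
  have : 0 ≤ (∑ j, p j * w j) / n := by positivity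
  unfold drift
  linarith

theorem neg_drift_le (h : BiasedStep β y p w) (i : Fin n) : -drift p w i ≤ 2 / n := by
  have h1 := h.sum_mul_w_le
  have : (∑ j, p j * w j) / n ≤ 2 / n := by gcongr
  have := mul_nonneg (h.p_nonneg i) (by linarith [h.one_le_w i] : 0 ≤ w i)
  unfold drift
  linarith

/-- The truncated exponential is an admissible `φ`. Of the error 3, the underloaded bins contribute
at most `∑ p j * w j ≤ 2`, and replacing the truncated sum by the whole potential costs at most 1.
-/
theorem sum_drift_mul_exp_le (h : BiasedStep β y p w) (hβ : 0 ≤ β) (hβ1 : β ≤ 1) (hn : 0 < n)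
    {a : ℝ} (ha : 0 ≤ a) :
    ∑ j, drift p w j * Real.exp (a * y j) ≤ -(β * underFrac y / n * expPot a y) + 3 := by
  have hn0 : (0 : ℝ) < n := by exact_mod_cast hn
  have hu0 := underFrac_nonneg y
  have hu1 : underFrac y ≤ 1 := by
    have := underFrac_add_overFrac hn y
    linarith [overFrac_nonneg y]
  have h1 := h.drift_over (fun j => if y j < 0 then 0 else Real.exp (a * y j))
    (fun i => by split_ifs <;> positivity) (fun i hi => if_pos hi) (fun i j hij => by
      split_ifs with h1 h2
      · rfl
      · positivity
      · linarith
      · exact Real.exp_le_exp.2 (by gcongr))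
  have h2 : expPot a y - n ≤ ∑ j, (if y j < 0 then 0 else Real.exp (a * y j)) := by
    have : (n : ℝ) = ∑ j : Fin n, 1 := by simp
    rw [expPot, this, ← sum_sub_distrib]
    refine sum_le_sum fun j _ => ?_
    split_ifs with hj
    · have : Real.exp (a * y j) ≤ 1 := Real.exp_le_one_iff.2 (by nlinarith)
      linarith
    · linarith
  have h3 : ∑ j, drift p w j * Real.exp (a * y j) ≤
      ∑ j, drift p w j * (if y j < 0 then 0 else Real.exp (a * y j)) + ∑ j, p j * w j := by
    rw [← sum_add_distrib]
    refine sum_le_sum fun j _ => ?_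
    have h4 := h.drift_le j
    have h5 := mul_nonneg (h.p_nonneg j) (by linarith [h.one_le_w j] : 0 ≤ w j)
    split_ifs with hj
    · have h6 : Real.exp (a * y j) ≤ 1 := Real.exp_le_one_iff.2 (by nlinarith)
      have h7 := Real.exp_pos (a * y j)
      nlinarith
    · linarith
  have h4 := h.sum_mul_w_le
  have h5 : β * underFrac y / n * (expPot a y - n) ≤
      β * underFrac y / n * ∑ j, (if y j < 0 then 0 else Real.exp (a * y j)) := by gcongr
  have h6 : β * underFrac y / n * (expPot a y - n) =
      β * underFrac y / n * expPot a y - β * underFrac y := by field_simp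
  have h7 : β * underFrac y ≤ 1 := by nlinarith
  linarith

theorem neg_sum_drift_mul_exp_le (h : BiasedStep β y p w) (hβ : 0 ≤ β) (hβ1 : β ≤ 1) (hn : 0 < n)
    {a : ℝ} (ha : 0 ≤ a) :
    -∑ j, drift p w j * Real.exp (-a * y j) ≤ -(β * overFrac y / n * expPot (-a) y) + 3 := by
  have hn0 : (0 : ℝ) < n := by exact_mod_cast hn
  have hu0 := overFrac_nonneg y
  have hu1 : overFrac y ≤ 1 := by
    have := underFrac_add_overFrac hn y
    linarith [underFrac_nonneg y]
  have h1 := h.drift_under (fun j => if 0 ≤ y j then 0 else Real.exp (-a * y j))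
    (fun i => by split_ifs <;> positivity) (fun i hi => if_pos hi) (fun i j hij => by
      split_ifs with h1 h2
      · rfl
      · positivity
      · linarith
      · exact Real.exp_le_exp.2 (by nlinarith))
  have h2 : expPot (-a) y - n ≤ ∑ j, (if 0 ≤ y j then 0 else Real.exp (-a * y j)) := by
    have : (n : ℝ) = ∑ j : Fin n, 1 := by simp
    rw [expPot, this, ← sum_sub_distrib]
    refine sum_le_sum fun j _ => ?_
    split_ifs with hj
    · have : Real.exp (-a * y j) ≤ 1 := Real.exp_le_one_iff.2 (by nlinarith)
      linarith
    · linarith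
  have h3 : ∑ j, drift p w j * (if 0 ≤ y j then 0 else Real.exp (-a * y j)) - ∑ j : Fin n, 2 / (n : ℝ) ≤
      ∑ j, drift p w j * Real.exp (-a * y j) := by
    rw [← sum_sub_distrib]
    refine sum_le_sum fun j _ => ?_
    have h4 := h.neg_drift_le j
    have h5 : 0 < 2 / (n : ℝ) := by positivity
    split_ifs with hj
    · have h6 : Real.exp (-a * y j) ≤ 1 := Real.exp_le_one_iff.2 (by nlinarith)
      have h7 := Real.exp_pos (-a * y j)
      nlinarith
    · linarith
  have h4 : ∑ j : Fin n, 2 / (n : ℝ) = 2 := by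
    simp; field_simp
  have h5 : β * overFrac y / n * (expPot (-a) y - n) ≤
      β * overFrac y / n * ∑ j, (if 0 ≤ y j then 0 else Real.exp (-a * y j)) := by gcongr
  have h6 : β * overFrac y / n * (expPot (-a) y - n) =
      β * overFrac y / n * expPot (-a) y - β * overFrac y := by field_simp
  have h7 : β * overFrac y ≤ 1 := by nlinarith
  linarith

end BiasedStep

/-- At least half of the bins have `|y j| ≤ 2 * C`, so `exp (2 * a * C)` is an admissible level `M`.
The resulting rate is free of `overFrac`. -/
theorem FavoursLowerHalf.neg_sum_drift_mul_exp_le {β : ℝ} {y p w : Fin n → ℝ}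
    (h : FavoursLowerHalf β y p w) (hn : 0 < n) {a C : ℝ} (ha : 0 ≤ a) (hC : 0 < C)
    (hy : ∑ j, |y j| ≤ C * n) :
    -∑ j, drift p w j * Real.exp (-a * y j) ≤
      -(β / (2 * n) * expPot (-a) y) + β / 2 * Real.exp (2 * a * C) := by
  have hn0 : (0 : ℝ) < n := by exact_mod_cast hn
  have h1 := h (fun j => Real.exp (-a * y j)) (fun i => (Real.exp_pos _).le)
    (fun i j hij => Real.exp_le_exp.2 (by nlinarith)) (Real.exp (2 * a * C)) (by
      have h2 := card_large_le y hC hy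
      have h3 : #{j | 2 * C < |y j|} + #{j | ¬ 2 * C < |y j|} = n := by
        simpa using card_filter_add_card_filter_not (s := (univ : Finset (Fin n)))
          (fun j => 2 * C < |y j|)
      have h4 : #{j | ¬ 2 * C < |y j|} ≤ #{j | Real.exp (-a * y j) ≤ Real.exp (2 * a * C)} := by
        refine card_le_card fun j hj => ?_
        simp only [mem_filter, mem_univ, true_and, not_lt, Real.exp_le_exp] at hj ⊢
        have := neg_abs_le (y j)
        nlinarith
      have h3' : (#{j | 2 * C < |y j|} : ℝ) + #{j | ¬ 2 * C < |y j|} = n := by exact_mod_cast h3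
      have h4' : (#{j | ¬ 2 * C < |y j|} : ℝ) ≤
        #{j | Real.exp (-a * y j) ≤ Real.exp (2 * a * C)} := by exact_mod_cast h4
      linarith)
  have h2 : β / (2 * n) * (∑ j, Real.exp (-a * y j) - n * Real.exp (2 * a * C)) =
      β / (2 * n) * expPot (-a) y - β / 2 * Real.exp (2 * a * C) := by
    unfold expPot; field_simp
  linarith

/-! ### The constants. -/

/-- The fraction of bins below which a step is treated as unbalanced. -/
def balanceTol (β : ℝ) : ℝ := Real.exp (-8 * (64 / β)) / (8 * (16 * Real.exp 4))

/-- The exponent of the exponential potential. -/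
def expRate (β : ℝ) : ℝ := β * balanceTol β ^ 2 / 8000

/-- The weight of the spread potential. -/
def spreadRate (β : ℝ) : ℝ := 4 * balanceTol β ^ 2 * expRate β

/-- The weight of the bounded correction terms. -/
def tauRate (β : ℝ) : ℝ := β * balanceTol β * expRate β / (2 * (16 * Real.exp 4))

/-- The relative drop of the combined potential is of order `dropRate β / n`. -/
def dropRate (β : ℝ) : ℝ := β * balanceTol β ^ 2 * expRate β / 4

section Constants

variable {β : ℝ}

theorem balanceTol_pos : 0 < balanceTol β := by unfold balanceTol; positivity

theorem balanceTol_le (hβ : 0 < β) : balanceTol β ≤ 1 / 128 := by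
  unfold balanceTol
  rw [div_le_div_iff₀ (by positivity) (by norm_num)]
  have h1 : Real.exp (-8 * (64 / β)) ≤ 1 := Real.exp_le_one_iff.2 (by
    have : 0 < 64 / β := by positivity
    linarith)
  have h2 := Real.add_one_le_exp (4 : ℝ)
  linarith

/-- The tolerance is tuned so that the few exceptional bins use up only half of the drop `exp (-8 *
C) / 4` in `sum_ite_neg_exp_le` for `C = 64 / β`. -/
theorem mul_balanceTol : 16 * Real.exp 4 * balanceTol β = Real.exp (-8 * (64 / β)) / 8 := by
  unfold balanceTol; field_simp

theorem expRate_pos (hβ : 0 < β) : 0 < expRate β := by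
  have := balanceTol_pos (β := β)
  unfold expRate; positivity

theorem expRate_le (hβ : 0 < β) (hβ1 : β ≤ 1) : expRate β ≤ 1 / 8000 := by
  have h1 := balanceTol_pos (β := β)
  have h2 := balanceTol_le hβ
  unfold expRate
  have : β * balanceTol β ^ 2 ≤ 1 * 1 ^ 2 := by gcongr; linarith
  linarith

theorem spreadRate_nonneg (hβ : 0 < β) : 0 ≤ spreadRate β := by
  have := expRate_pos hβ
  unfold spreadRate; positivity

theorem eight_mul_spreadRate_le (hβ : 0 < β) : 8 * spreadRate β ≤ expRate β := by
  have h0 := expRate_pos hβ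
  have h1 := balanceTol_pos (β := β)
  have h2 := balanceTol_le hβ
  unfold spreadRate
  have : 32 * balanceTol β ^ 2 ≤ 1 := by nlinarith
  nlinarith

/-- The left side is the worst growth rate of the spread, so `dropRate` is the common unit for all
drifts. -/
theorem spreadRate_mul : spreadRate β * β / 16 = dropRate β := by
  unfold spreadRate dropRate; ring

theorem tauRate_nonneg (hβ : 0 < β) : 0 ≤ tauRate β := by
  have := expRate_pos hβ
  have h1 := balanceTol_pos (β := β)
  unfold tauRate; positivity

/-- The worst growth of the correction is half the exponential contraction at fraction `balanceTol
β`. Multiplied by `balanceTol β`, it equals `2 * dropRate β`, which covers the growth of the spread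
and leaves one unit. -/
theorem tauRate_mul : tauRate β * (16 * Real.exp 4) = β * balanceTol β * expRate β / 2 := by
  unfold tauRate; field_simp

theorem tauRate_mul_le (hβ : 0 < β) (hβ1 : β ≤ 1) : tauRate β * (16 * Real.exp 4) ≤ expRate β := by
  have h0 := expRate_pos hβ
  have h1 := balanceTol_pos (β := β)
  have h2 := balanceTol_le hβ
  rw [tauRate_mul]
  have : β * balanceTol β ≤ 1 * 1 := by gcongr; linarith
  nlinarith

theorem dropRate_pos (hβ : 0 < β) : 0 < dropRate β := by
  have := expRate_pos hβ
  have h1 := balanceTol_pos (β := β)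
  unfold dropRate; positivity

/-- Fixes the size of `expRate`: `412 = 2 * (12 + 194)` collects all second-order terms, which must
be small against the first-order drop. -/
theorem expRate_sq_le (hβ : 0 < β) : 412 * expRate β ^ 2 ≤ dropRate β / 4 := by
  have h0 := expRate_pos hβ
  have h1 : 0 < β * balanceTol β ^ 2 := by
    have := balanceTol_pos (β := β)
    positivity
  have h2 : 412 * expRate β ≤ β * balanceTol β ^ 2 / 16 := by unfold expRate; linarith
  unfold dropRate
  nlinarith

theorem dropRate_le (hβ : 0 < β) : dropRate β ≤ expRate β * β / 4 := by
  have h0 := expRate_pos hβ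
  have h1 := balanceTol_pos (β := β)
  have h2 := balanceTol_le hβ
  have : balanceTol β ^ 2 ≤ 1 := by nlinarith
  unfold dropRate
  have : β * expRate β * balanceTol β ^ 2 ≤ β * expRate β * 1 := by gcongr
  linarith

end Constants

/-! ### Balancing correction, spread and exponential potential. -/

/-- The bounded correction term. -/
def correction (ξ s : ℝ) (y : Fin n → ℝ) : ℝ := ξ * ((∑ j, tau (s * y j)) / n)

theorem correction_nonpos {ξ : ℝ} (hξ : 0 ≤ ξ) (s : ℝ) (y : Fin n → ℝ) : correction ξ s y ≤ 0 :=
  mul_nonpos_of_nonneg_of_nonpos hξ (div_nonpos_of_nonpos_of_nonneg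
    (sum_nonpos fun _ _ => tau_nonpos _) (Nat.cast_nonneg n))

theorem le_correction {ξ : ℝ} (hξ : 0 ≤ ξ) (hn : 0 < n) (s : ℝ) (y : Fin n → ℝ) :
    -(ξ * Real.exp 4) ≤ correction ξ s y := by
  have hn0 : (0 : ℝ) < n := by exact_mod_cast hn
  unfold correction
  rw [← mul_neg]
  gcongr
  rw [le_div_iff₀ hn0]
  calc -Real.exp 4 * n = ∑ _j : Fin n, -Real.exp 4 := by simp; ring
    _ ≤ _ := sum_le_sum fun j _ => neg_exp_four_le_tau _

theorem correction_bump (ξ s : ℝ) (y w : Fin n → ℝ) (i : Fin n) :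
    correction ξ s (bump y w i) = correction ξ s y + ξ * tauStep s y w i := by
  unfold correction tauStep
  rw [sum_sub_distrib]
  ring

namespace BiasedStep

variable {β : ℝ} {y p w : Fin n → ℝ}

theorem sum_mul_tauStep (s : ℝ) (y p w : Fin n → ℝ) :
    ∑ i, p i * tauStep s y w i =
      (∑ j, ∑ i, p i * (tau (s * bump y w i j) - tau (s * y j))) / n := by
  rw [sum_comm, sum_div]
  refine sum_congr rfl fun i _ => ?_
  rw [tauStep, ← mul_sum, mul_div_assoc]

/-- The expected change of the correction term, compared with the fraction `q` of the bins for
which the increment may be positive. -/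
theorem sum_mul_tauStep_le (s : ℝ) (hn : 0 < n) (P : Fin n → Prop)
    [DecidablePred P] {q : ℝ} (hq : q = (#{j | ¬ P j} : ℝ) / n) (hq1 : q ≤ 1) (hβ : 0 < β)
    (hP : ∀ j, ∑ i, p i * (tau (s * bump y w i j) - tau (s * y j)) ≤
      if P j then -(Real.exp (-4 * |y j|) / n) else 16 * Real.exp 4 / n) :
    ∑ i, p i * tauStep s y w i ≤ 16 * Real.exp 4 / n ∧
    (q ≤ balanceTol β → ∑ i, p i * tauStep s y w i ≤ 16 * Real.exp 4 * balanceTol β / n) ∧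
    (q ≤ balanceTol β → ∑ j, |y j| ≤ 64 / β * n →
      ∑ i, p i * tauStep s y w i ≤ -(16 * Real.exp 4 * balanceTol β / n)) := by
  have hn0 : (0 : ℝ) < n := by exact_mod_cast hn
  have h1 := sum_le_sum fun j (_ : j ∈ univ) => hP j
  rw [sum_mul_tauStep]
  have h2 := h1.trans (sum_ite_neg_exp_le_card y P)
  rw [← hq] at h2
  refine ⟨?_, fun h => ?_, fun h hy => ?_⟩
  · gcongr
    nlinarith [Real.exp_pos 4]
  · gcongr
    exact h2.trans (by gcongr)
  · rw [← neg_div]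
    gcongr
    have h3 := h1.trans (sum_ite_neg_exp_le y P hn (e := balanceTol β) (by
      rw [hq, div_le_iff₀ hn0] at h; exact h) (by linarith [balanceTol_le hβ]) (by positivity)
      (by positivity : 0 < 64 / β) hy)
    have := mul_balanceTol (β := β)
    linarith

/-- The drifts of the correction term, of the spread potential and of the exponential potential
add up to a drop. -/
theorem combined_drift_le (h : BiasedStep β y p w) (s : ℝ) (hn : 0 < n) (hβ : 0 < β)
    (hy : ∑ j, y j = 0) {q : ℝ}
    (h1 : ∑ i, p i * tauStep s y w i ≤ 16 * Real.exp 4 / n)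
    (h2 : q ≤ balanceTol β → ∑ i, p i * tauStep s y w i ≤ 16 * Real.exp 4 * balanceTol β / n)
    (h3 : q ≤ balanceTol β → ∑ j, |y j| ≤ 64 / β * n →
      ∑ i, p i * tauStep s y w i ≤ -(16 * Real.exp 4 * balanceTol β / n)) (hq0 : 0 ≤ q) :
    tauRate β * ∑ i, p i * tauStep s y w i +
      ∑ i, p i * spreadStep (spreadRate β) (64 / β) y w i - expRate β * (β * q / n) ≤
        -(dropRate β / n) := by
  have hn0 : (0 : ℝ) < n := by exact_mod_cast hn
  have hξ := tauRate_nonneg hβ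
  have hα := expRate_pos hβ
  have he := balanceTol_pos (β := β)
  have hS := h.sum_spreadStep_le_always hβ (spreadRate_nonneg hβ) hn hy
  rw [spreadRate_mul] at hS
  have hm := tauRate_mul (β := β)
  have hb : tauRate β * (16 * Real.exp 4 * balanceTol β / n) = 2 * (dropRate β / n) := by
    have : tauRate β * (16 * Real.exp 4 * balanceTol β / n) =
      tauRate β * (16 * Real.exp 4) * balanceTol β / n := by ring
    rw [this, hm]; unfold dropRate; ring
  have hbn : 0 ≤ dropRate β / n := div_nonneg (dropRate_pos hβ).le hn0.le
  have hqn : 0 ≤ expRate β * (β * q / n) := by positivity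
  -- In units of `dropRate β / n`: for small `q` and small deviations, the correction gives `-2` and
  -- the spread at most `+1`; for small `q` and large deviations, at most `+2` and `-4`; for large
  -- `q`, the exponential drift is at most `-4`, the correction costs at most half of it, and the
  -- spread at most `+1`.
  rcases le_or_gt q (balanceTol β) with hq | hq
  · rcases le_total (∑ j, |y j|) (64 / β * n) with hD | hD
    · have := mul_le_mul_of_nonneg_left (h3 hq hD) hξ
      linarith
    · have h4 := mul_le_mul_of_nonneg_left (h2 hq) hξ
      have h5 := h.sum_spreadStep_le_of_large hβ (spreadRate_nonneg hβ) hn hy hD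
      rw [spreadRate_mul] at h5
      have : 4 * dropRate β / n = 4 * (dropRate β / n) := by ring
      linarith
  · have h4 := mul_le_mul_of_nonneg_left h1 hξ
    have h5 : tauRate β * (16 * Real.exp 4 / n) = expRate β * (β * balanceTol β / n) / 2 := by
      rw [← mul_div_assoc, hm]; ring
    have h6 : expRate β * (β * balanceTol β / n) ≤ expRate β * (β * q / n) := by gcongr
    have h7 : dropRate β / n * 4 ≤ expRate β * (β * balanceTol β / n) := by
      unfold dropRate
      have h8 : balanceTol β ^ 2 ≤ balanceTol β := by nlinarith [balanceTol_le hβ]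
      calc β * balanceTol β ^ 2 * expRate β / 4 / n * 4 =
          expRate β * (β * balanceTol β ^ 2 / n) := by field_simp
        _ ≤ _ := by gcongr
    linarith

/-- One step of a single exponential potential, weighted with the spread potential and a
correction term. -/
theorem sum_weighted_expPot_le (h : BiasedStep β y p w) (hn : 0 < n) (hβ : 0 < β) (hβ1 : β ≤ 1)
    (hy : ∑ j, y j = 0) {s : ℝ} (hs : |s| = 1) {ξ : ℝ} (hξ0 : 0 ≤ ξ) (hξ : ξ ≤ tauRate β) :
    ∑ i, p i * (Real.exp (spread (spreadRate β) (64 / β) (bump y w i)) *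
      (Real.exp (correction ξ s (bump y w i)) * expPot (s * expRate β) (bump y w i))) ≤
    Real.exp (spread (spreadRate β) (64 / β) y) * (Real.exp (correction ξ s y) *
      (expPot (s * expRate β) y * (1 + (ξ * ∑ i, p i * tauStep s y w i +
        ∑ i, p i * spreadStep (spreadRate β) (64 / β) y w i) + dropRate β / 4 / n) +
        expRate β * (s * ∑ j, drift p w j * Real.exp (s * expRate β * y j)))) := by
  have hn1 : (1 : ℝ) ≤ n := by exact_mod_cast hn
  have hn0 : (0 : ℝ) < n := by linarith
  set σ := spreadRate β with hσdef
  set A := 64 / β with hA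
  set α := expRate β with hαdef
  have hA0 : 0 < A := by positivity
  have hA1 : 1 ≤ A := by rw [hA, le_div_iff₀ hβ]; linarith
  have hσ : 0 ≤ σ := spreadRate_nonneg hβ
  have hα0 : 0 < α := expRate_pos hβ
  have hα1 : α ≤ 1 / 8000 := expRate_le hβ hβ1
  have h8 : 8 * σ ≤ α := eight_mul_spreadRate_le hβ
  set θ := tauStep s y w with hθ
  set S := spreadStep σ A y w with hS
  have hξθ : ∀ i, |ξ * θ i| ≤ α / n := by
    intro i
    rw [abs_mul, abs_of_nonneg hξ0]
    calc ξ * |θ i| ≤ tauRate β * (16 * Real.exp 4 / n) := by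
          gcongr
          · exact tauRate_nonneg hβ
          · exact h.abs_tauStep_le hs i
      _ = tauRate β * (16 * Real.exp 4) / n := by ring
      _ ≤ α / n := by gcongr; exact tauRate_mul_le hβ hβ1
  have hαn : α / n ≤ α := div_le_self hα0.le hn1
  have hS8 : ∀ i, |S i| ≤ 8 * σ := fun i => h.abs_spreadStep_le hσ hA1 hn i
  have hr : ∀ i, |ξ * θ i + S i| ≤ 1 / 2 := fun i =>
    (abs_add_le _ _).trans (by linarith [hξθ i, hS8 i])
  have hρ : ∑ i, p i * (ξ * θ i + S i) ^ 2 ≤ 194 * α ^ 2 / n := by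
    have h1 : ∀ i, p i * (ξ * θ i + S i) ^ 2 ≤ 2 * (p i * (α ^ 2 / n)) + 2 * (p i * S i ^ 2) := by
      intro i
      have h2 : (ξ * θ i) ^ 2 ≤ α ^ 2 / n := by
        calc (ξ * θ i) ^ 2 ≤ (α / n) ^ 2 := sq_le_sq' (by linarith [neg_le_of_abs_le (hξθ i)])
              (le_of_abs_le (hξθ i))
          _ = α / n * (α / n) := sq _
          _ ≤ α / n * α := by gcongr
          _ = α ^ 2 / n := by ring
      have h3 : (ξ * θ i + S i) ^ 2 ≤ 2 * (α ^ 2 / n) + 2 * S i ^ 2 := by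
        nlinarith [sq_nonneg (ξ * θ i - S i)]
      calc p i * (ξ * θ i + S i) ^ 2 ≤ p i * (2 * (α ^ 2 / n) + 2 * S i ^ 2) := by
            gcongr
            exact h.p_nonneg i
        _ = _ := by ring
    refine (sum_le_sum fun i _ => h1 i).trans ?_
    rw [sum_add_distrib, ← mul_sum, ← mul_sum, ← sum_mul, h.p_sum]
    have h4 := h.sum_spreadStep_sq_le (σ := σ) hA1 hn
    have h5 : 96 * σ ^ 2 / n ≤ 96 * α ^ 2 / n := by gcongr; linarith
    have h6 : 194 * α ^ 2 / n = 2 * (1 * (α ^ 2 / n)) + 2 * (96 * α ^ 2 / n) := by ring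
    linarith
  have ha : |s * α| = α := by rw [abs_mul, hs, one_mul, abs_of_pos hα0]
  have hmain := h.sum_exp_mul_expPot_le (a := s * α) (by rw [ha]; linarith) hr hρ
  have hs2 : s ^ 2 = 1 := by rw [← sq_abs, hs, one_pow]
  have hsecond : 2 * (12 * (s * α) ^ 2 / n + 194 * α ^ 2 / n) ≤ dropRate β / 4 / n := by
    have : 2 * (12 * (s * α) ^ 2 / n + 194 * α ^ 2 / n) = 412 * α ^ 2 / n := by
      rw [mul_pow, hs2]; ring
    rw [this]
    gcongr
    exact expRate_sq_le hβ
  have hsum : ∑ i, p i * (ξ * θ i + S i) = ξ * ∑ i, p i * θ i + ∑ i, p i * S i := by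
    rw [mul_sum, ← sum_add_distrib]; exact sum_congr rfl fun i _ => by ring
  rw [hsum] at hmain
  have hstep : ∀ i, p i * (Real.exp (spread σ A (bump y w i)) *
      (Real.exp (correction ξ s (bump y w i)) * expPot (s * α) (bump y w i))) ≤
      Real.exp (spread σ A y) * (Real.exp (correction ξ s y) *
        (p i * (Real.exp (ξ * θ i + S i) * expPot (s * α) (bump y w i)))) := by
    intro i
    have h1 := spread_bump_le hσ (by positivity : 0 < A * n) y w hy i
    rw [correction_bump]
    calc _ ≤ p i * (Real.exp (spread σ A y + S i) *
          (Real.exp (correction ξ s y + ξ * θ i) * expPot (s * α) (bump y w i))) := by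
          have := expPot_nonneg (s * α) (bump y w i)
          gcongr
          exact h.p_nonneg i
      _ = _ := by
          rw [Real.exp_add, Real.exp_add, Real.exp_add]; ring
  refine (sum_le_sum fun i _ => hstep i).trans ?_
  rw [← mul_sum, ← mul_sum]
  gcongr
  refine hmain.trans ?_
  have := mul_le_mul_of_nonneg_left hsecond (expPot_nonneg (s * α) y)
  have e : α * (s * ∑ j, drift p w j * Real.exp (s * α * y j)) =
    s * α * ∑ j, drift p w j * Real.exp (s * α * y j) := by ring
  rw [e]
  linarith

end BiasedStep

/-! ### The drift of the combined potential. -/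

/-- The combined potential. -/
def totalPot (β ξ : ℝ) (y : Fin n → ℝ) : ℝ :=
  Real.exp (spread (spreadRate β) (64 / β) y) *
    (Real.exp (correction (tauRate β) 1 y) * expPot (1 * expRate β) y +
      Real.exp (correction ξ (-1) y) * expPot (-1 * expRate β) y)

/-- The additive error in the drift of the exponential potentials. -/
def driftError (β : ℝ) : ℝ := 3 + Real.exp (128 / β)

namespace BiasedStep

variable {β : ℝ} {y p w : Fin n → ℝ}

theorem sum_over_le (h : BiasedStep β y p w) (hn : 8 ≤ n) (hβ : 0 < β) (hβ1 : β ≤ 1)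
    (hy : ∑ j, y j = 0) :
    ∑ i, p i * (Real.exp (spread (spreadRate β) (64 / β) (bump y w i)) *
      (Real.exp (correction (tauRate β) 1 (bump y w i)) *
        expPot (1 * expRate β) (bump y w i))) ≤
    Real.exp (spread (spreadRate β) (64 / β) y) * (Real.exp (correction (tauRate β) 1 y) *
      expPot (1 * expRate β) y * (1 - 3 / 4 * (dropRate β / n)) + driftError β) := by
  have hn' : 0 < n := by lia
  have hα := expRate_pos hβ
  have hα1 := expRate_le hβ hβ1
  refine (h.sum_weighted_expPot_le hn' hβ hβ1 hy (abs_one) (tauRate_nonneg hβ) le_rfl).trans ?_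
  have hu : underFrac y = (#{j | ¬ 0 ≤ y j} : ℝ) / n := by simp only [underFrac, not_le]
  have hu1 : underFrac y ≤ 1 := by
    have := underFrac_add_overFrac hn' y
    linarith [overFrac_nonneg y]
  obtain ⟨h1, h2, h3⟩ := sum_mul_tauStep_le 1 hn' _ hu hu1 hβ (h.sum_tau_over hn)
  have hX := h.combined_drift_le 1 hn' hβ hy h1 h2 h3 (underFrac_nonneg y)
  set X := tauRate β * ∑ i, p i * tauStep 1 y w i +
      ∑ i, p i * spreadStep (spreadRate β) (64 / β) y w i
  have hd := h.sum_drift_mul_exp_le hβ.le hβ1 hn' hα.le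
  rw [one_mul, one_mul]
  have hΦ := expPot_nonneg (expRate β) y
  have hT := Real.exp_le_one_iff.2 (correction_nonpos (tauRate_nonneg hβ) 1 y)
  have hT0 := Real.exp_pos (correction (tauRate β) 1 y)
  set T := Real.exp (correction (tauRate β) 1 y)
  gcongr
  have hmain : expPot (expRate β) y * (1 + X + dropRate β / 4 / n) +
      expRate β * ∑ j, drift p w j * Real.exp (expRate β * y j) ≤
      expPot (expRate β) y * (1 - 3 / 4 * (dropRate β / n)) + 3 := by
    have h4 := mul_le_mul_of_nonneg_left hd hα.le
    have h5 := mul_le_mul_of_nonneg_left hX hΦ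
    have h6 : dropRate β / 4 / n = dropRate β / n / 4 := by ring
    rw [h6]
    nlinarith
  have hE : (3 : ℝ) ≤ driftError β := by unfold driftError; linarith [Real.exp_pos (128 / β)]
  have := mul_le_mul_of_nonneg_left hmain hT0.le
  nlinarith

theorem sum_under_le (h : BiasedStep β y p w) (hn : 8 ≤ n) (hβ : 0 < β) (hβ1 : β ≤ 1)
    (hy : ∑ j, y j = 0) {ξ : ℝ} (hlow : ξ = tauRate β ∧ SamplesUnderloaded y p ∨
      ξ = 0 ∧ FavoursLowerHalf β y p w) :
    ∑ i, p i * (Real.exp (spread (spreadRate β) (64 / β) (bump y w i)) *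
      (Real.exp (correction ξ (-1) (bump y w i)) *
        expPot (-1 * expRate β) (bump y w i))) ≤
    Real.exp (spread (spreadRate β) (64 / β) y) * (Real.exp (correction ξ (-1) y) *
      expPot (-1 * expRate β) y * (1 - 3 / 4 * (dropRate β / n)) + driftError β) := by
  have hn' : 0 < n := by lia
  have hn0 : (0 : ℝ) < n := by exact_mod_cast hn'
  have hα := expRate_pos hβ
  have hα1 := expRate_le hβ hβ1
  have hξ : 0 ≤ ξ ∧ ξ ≤ tauRate β := by
    rcases hlow with ⟨rfl, -⟩ | ⟨rfl, -⟩
    · exact ⟨tauRate_nonneg hβ, le_rfl⟩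
    · exact ⟨le_rfl, tauRate_nonneg hβ⟩
  refine (h.sum_weighted_expPot_le hn' hβ hβ1 hy (s := -1) (by simp) hξ.1 hξ.2).trans ?_
  have hd := h.neg_sum_drift_mul_exp_le hβ.le hβ1 hn' hα.le
  have hΦ := expPot_nonneg (-expRate β) y
  have hT := Real.exp_le_one_iff.2 (correction_nonpos hξ.1 (-1) y)
  have hT0 := Real.exp_pos (correction ξ (-1) y)
  set T := Real.exp (correction ξ (-1) y)
  rw [neg_one_mul, neg_one_mul]
  gcongr
  suffices hmain : expPot (-expRate β) y * (1 + (ξ * ∑ i, p i * tauStep (-1) y w i +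
      ∑ i, p i * spreadStep (spreadRate β) (64 / β) y w i) + dropRate β / 4 / n) +
      expRate β * -∑ j, drift p w j * Real.exp (-expRate β * y j) ≤
      expPot (-expRate β) y * (1 - 3 / 4 * (dropRate β / n)) + driftError β by
    have hE : 0 ≤ driftError β := by unfold driftError; positivity
    have := mul_le_mul_of_nonneg_left hmain hT0.le
    nlinarith
  have h6 : dropRate β / 4 / n = dropRate β / n / 4 := by ring
  rw [h6]
  rcases hlow with ⟨rfl, hs⟩ | ⟨rfl, hf⟩
  · have hu : overFrac y = (#{j | ¬ y j < 0} : ℝ) / n := by simp only [overFrac, not_lt]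
    have hu1 : overFrac y ≤ 1 := by
      have := underFrac_add_overFrac hn' y
      linarith [underFrac_nonneg y]
    obtain ⟨h1, h2, h3⟩ := sum_mul_tauStep_le (-1) hn' _ hu hu1 hβ (h.sum_tau_under hs hn)
    have hX := h.combined_drift_le (-1) hn' hβ hy h1 h2 h3 (overFrac_nonneg y)
    set X := tauRate β * ∑ i, p i * tauStep (-1) y w i +
      ∑ i, p i * spreadStep (spreadRate β) (64 / β) y w i
    have h4 := mul_le_mul_of_nonneg_left hd hα.le
    have h5 := mul_le_mul_of_nonneg_left hX hΦ
    have hE : (3 : ℝ) ≤ driftError β := by unfold driftError; linarith [Real.exp_pos (128 / β)]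
    nlinarith
  · rw [zero_mul, zero_add]
    set X := ∑ i, p i * spreadStep (spreadRate β) (64 / β) y w i with hXdef
    have hbn : 0 ≤ dropRate β / n := div_nonneg (dropRate_pos hβ).le hn0.le
    -- No correction is present here. For small deviations the lower-half contraction is worth two
    -- units of `dropRate β / n`, against one for the growth of the spread; for large deviations the
    -- drop of the spread suffices.
    rcases le_total (∑ j, |y j|) (64 / β * n) with hD | hD
    · have hX := h.sum_spreadStep_le_always hβ (spreadRate_nonneg hβ) hn' hy
      rw [spreadRate_mul, ← hXdef] at hX
      have h4 := mul_le_mul_of_nonneg_left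
        (hf.neg_sum_drift_mul_exp_le hn' hα.le (by positivity : 0 < 64 / β) hD) hα.le
      have h5 : dropRate β / n * 2 ≤ expRate β * (β / (2 * n)) := by
        calc dropRate β / n * 2 ≤ expRate β * β / 4 / n * 2 := by
              gcongr; exact dropRate_le hβ
          _ = _ := by ring
      have h7 : expRate β * (β / 2 * Real.exp (2 * expRate β * (64 / β))) ≤ driftError β := by
        have h8 : Real.exp (2 * expRate β * (64 / β)) ≤ Real.exp (128 / β) := by
          apply Real.exp_le_exp.2
          have : 128 / β = 2 * 1 * (64 / β) := by ring
          rw [this]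
          gcongr
          linarith
        have h9 : expRate β * (β / 2) ≤ 1 * 1 := by gcongr <;> linarith
        unfold driftError
        calc expRate β * (β / 2 * Real.exp (2 * expRate β * (64 / β)))
            = expRate β * (β / 2) * Real.exp (2 * expRate β * (64 / β)) := by ring
          _ ≤ 1 * 1 * Real.exp (128 / β) := by gcongr
          _ ≤ _ := by linarith
      have h10 : X - expRate β * (β / (2 * n)) ≤ -(dropRate β / n) := by linarith
      have h11 := mul_le_mul_of_nonneg_left h10 hΦ
      linarith
    · have hX := h.sum_spreadStep_le_of_large hβ (spreadRate_nonneg hβ) hn' hy hD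
      rw [spreadRate_mul, ← hXdef] at hX
      have h4 := mul_le_mul_of_nonneg_left hd hα.le
      have h5 : 0 ≤ expRate β * (β * overFrac y / n * expPot (-expRate β) y) := by
        have := overFrac_nonneg y
        positivity
      have h7 : 4 * dropRate β / n = 4 * (dropRate β / n) := by ring
      have h10 : X ≤ -(dropRate β / n) := by linarith
      have h11 := mul_le_mul_of_nonneg_left h10 hΦ
      have hE : (3 : ℝ) ≤ driftError β := by unfold driftError; linarith [Real.exp_pos (128 / β)]
      nlinarith

end BiasedStep

theorem exp_neg_one_le_exp_correction {β ξ : ℝ} (hβ : 0 < β) (hβ1 : β ≤ 1) (hn : 0 < n)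
    (hξ : 0 ≤ ξ) (hξ1 : ξ ≤ tauRate β) (s : ℝ) (y : Fin n → ℝ) :
    Real.exp (-1) ≤ Real.exp (correction ξ s y) := by
  apply Real.exp_le_exp.2
  refine le_trans ?_ (le_correction hξ hn s y)
  have h1 := tauRate_mul_le hβ hβ1
  have h2 := expRate_le hβ hβ1
  have h3 : ξ * Real.exp 4 ≤ tauRate β * Real.exp 4 := by gcongr
  have h4 : 0 ≤ ξ * Real.exp 4 := by positivity
  linarith

theorem le_totalPot {β ξ : ℝ} (hβ : 0 < β) (hβ1 : β ≤ 1) (hn : 0 < n)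
    (hξ : 0 ≤ ξ) (hξ1 : ξ ≤ tauRate β) (y : Fin n → ℝ) :
    Real.exp (spread (spreadRate β) (64 / β) y) *
      (Real.exp (-1) * (expPot (expRate β) y + expPot (-expRate β) y)) ≤ totalPot β ξ y := by
  unfold totalPot
  rw [one_mul, neg_one_mul, mul_add]
  have h1 := exp_neg_one_le_exp_correction hβ hβ1 hn (tauRate_nonneg hβ) le_rfl 1 y
  have h2 := exp_neg_one_le_exp_correction hβ hβ1 hn hξ hξ1 (-1) y
  have h3 := expPot_nonneg (expRate β) y
  have h4 := expPot_nonneg (-expRate β) y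
  gcongr

theorem sum_sq_le {a : ℝ} (ha : 0 < a) (y : Fin n → ℝ) :
    ∑ j, y j ^ 2 ≤ 2 / a ^ 2 * (expPot a y + expPot (-a) y) := by
  unfold expPot
  rw [← sum_add_distrib, mul_sum]
  refine sum_le_sum fun j _ => ?_
  have h1 : (a * y j) ^ 2 / 2 ≤ Real.exp |a * y j| := by
    have := Real.quadratic_le_exp_of_nonneg (abs_nonneg (a * y j))
    rw [sq_abs] at this
    linarith [abs_nonneg (a * y j)]
  have h2 : Real.exp |a * y j| ≤ Real.exp (a * y j) + Real.exp (-a * y j) := by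
    rw [neg_mul]
    rcases abs_choice (a * y j) with h | h <;> rw [h]
    · linarith [Real.exp_pos (-(a * y j))]
    · linarith [Real.exp_pos (a * y j)]
  calc y j ^ 2 = 2 / a ^ 2 * ((a * y j) ^ 2 / 2) := by field_simp
    _ ≤ _ := by gcongr; linarith

/-- The expected combined potential drops, up to a bounded error. -/
theorem exists_sum_totalPot_le {β : ℝ} (hβ : 0 < β) (hβ1 : β ≤ 1) :
    ∃ c K : ℝ, 0 < c ∧ 0 < K ∧ ∀ (n : ℕ), 8 ≤ n → ∀ (y p w : Fin n → ℝ) (ξ : ℝ),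
      BiasedStep β y p w → ∑ j, y j = 0 →
      (ξ = tauRate β ∧ SamplesUnderloaded y p ∨ ξ = 0 ∧ FavoursLowerHalf β y p w) →
      ∑ i, p i * totalPot β ξ (bump y w i) ≤ (1 - c / n) * totalPot β ξ y + K := by
  set b := dropRate β with hb
  set α := expRate β with hα
  set E := driftError β with hE
  set σ := spreadRate β with hσ
  have hb0 : 0 < b := dropRate_pos hβ
  have hα0 : 0 < α := expRate_pos hβ
  have hσ0 : 0 ≤ σ := spreadRate_nonneg hβ
  have hE0 : 0 < E := by rw [hE]; unfold driftError; positivity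
  -- Chosen so that `b / (4 n) * exp (-1) * (C n) = 2 E`.
  set C := 8 * Real.exp 1 * E / b with hC
  have hC0 : 0 < C := by positivity
  refine ⟨b / 2, 2 * E * Real.exp (σ * (2 / α ^ 2 * C) / (64 / β)), by positivity, by positivity,
    fun n hn y p w ξ h hy hlow => ?_⟩
  have hn' : 0 < n := by lia
  have hn0 : (0 : ℝ) < n := by exact_mod_cast hn'
  have hξ : 0 ≤ ξ ∧ ξ ≤ tauRate β := by
    rcases hlow with ⟨rfl, -⟩ | ⟨rfl, -⟩
    · exact ⟨tauRate_nonneg hβ, le_rfl⟩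
    · exact ⟨le_rfl, tauRate_nonneg hβ⟩
  have h1 := h.sum_over_le hn hβ hβ1 hy
  have h2 := h.sum_under_le hn hβ hβ1 hy hlow
  have h3 := le_totalPot hβ hβ1 hn' hξ.1 hξ.2 y
  have hsum : ∑ i, p i * totalPot β ξ (bump y w i) ≤
      (1 - 3 / 4 * (b / n)) * totalPot β ξ y +
        2 * E * Real.exp (spread σ (64 / β) y) := by
    have := add_le_add h1 h2
    rw [← sum_add_distrib] at this
    calc _ = _ := sum_congr rfl fun i _ => by rw [totalPot, mul_add, mul_add]
      _ ≤ _ := this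
      _ = _ := by unfold totalPot; ring
  refine hsum.trans ?_
  set S := Real.exp (spread σ (64 / β) y) with hS
  have hS0 : 0 < S := Real.exp_pos _
  set F := totalPot β ξ y
  have hF0 : 0 ≤ F := le_trans (by
    have := expPot_nonneg α y
    have := expPot_nonneg (-α) y
    positivity) h3
  set G := expPot α y + expPot (-α) y with hG
  -- For large `G` the error `2 * E * S` is absorbed by part of the contraction, as `S` is also a
  -- factor of the potential. For small `G` the squares sum to `O(n)`, so `S` is bounded.
  rcases le_total (C * n) G with hc | hc
  · have h4 : 2 * E * S ≤ b / n / 4 * F := by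
      calc 2 * E * S = b / n / 4 * (S * (Real.exp (-1) * (C * n))) := by
            rw [hC, Real.exp_neg]; field_simp; ring
        _ ≤ b / n / 4 * (S * (Real.exp (-1) * G)) := by gcongr
        _ ≤ _ := by gcongr
    have h5 : 0 ≤ 2 * E * Real.exp (σ * (2 / α ^ 2 * C) / (64 / β)) := by positivity
    have h6 : b / 2 / n = b / n / 2 := by ring
    rw [h6]
    linarith
  · have h4 : S ≤ Real.exp (σ * (2 / α ^ 2 * C) / (64 / β)) := by
      apply Real.exp_le_exp.2
      refine (spread_le hσ0 (by positivity) y).trans ?_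
      calc σ * (∑ j, y j ^ 2) / (64 / β * n)
          ≤ σ * (2 / α ^ 2 * (C * n)) / (64 / β * n) := by
            gcongr
            exact (sum_sq_le hα0 y).trans (by gcongr)
        _ = _ := by field_simp
    have h5 : 2 * E * S ≤ 2 * E * Real.exp (σ * (2 / α ^ 2 * C) / (64 / β)) := by gcongr
    have h6 : b / 2 / n = b / n / 2 := by ring
    have h7 : 0 ≤ b / n * F := by positivity
    rw [h6]
    linarith

/-! ### From load vectors to the tail bound. -/

/-- The deviations of the loads from the mean load. -/
def dev (x : Load n) : Fin n → ℝ := fun i => (x i : ℝ) - meanLoad x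

theorem sum_dev [NeZero n] (x : Load n) : ∑ i, dev x i = 0 := by
  have hn : (n : ℝ) ≠ 0 := Nat.cast_ne_zero.2 (NeZero.ne n)
  simp only [dev, sum_sub_distrib, sum_const, card_univ, Fintype.card_fin, nsmul_eq_mul, meanLoad,
    totalLoad, Nat.cast_sum]
  field_simp
  ring

theorem totalLoad_allocate (x : Load n) (i : Fin n) (w : ℕ) :
    totalLoad (allocate x i w) = totalLoad x + w := by
  unfold totalLoad allocate
  rw [sum_update_of_mem (mem_univ i), ← add_sum_erase univ x (mem_univ i), sdiff_singleton_eq_erase]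
  ring

theorem dev_allocate (x : Load n) (w : Fin n → ℕ) (i : Fin n) :
    dev (allocate x i (w i)) = bump (dev x) (fun j => (w j : ℝ)) i := by
  funext j
  unfold bump dev meanLoad
  rw [totalLoad_allocate]
  unfold allocate
  by_cases h : j = i
  · subst h
    simp
    ring
  · simp [h]
    ring

/-- The law `μ` is that of putting `w i` balls into bin `i` with probability `p i`. -/
def IsStep (μ : PMF (Load n)) (x : Load n) (p : Fin n → ℝ) (w : Fin n → ℕ) : Prop :=
  ∀ f : Load n → ENNReal, ∑' z, μ z * f z = ∑ i, ENNReal.ofReal (p i) * f (allocate x i (w i))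

theorem tsum_bind_mul {α γ : Type*} (P : PMF α) (g : α → PMF γ) (f : γ → ENNReal) :
    ∑' z, P.bind g z * f z = ∑' a, P a * ∑' z, g a z * f z := by
  simp only [PMF.bind_apply, ← ENNReal.tsum_mul_right, ← ENNReal.tsum_mul_left]
  rw [ENNReal.tsum_comm]
  simp only [mul_assoc]

theorem tsum_pure_mul {α : Type*} (a : α) (f : α → ENNReal) :
    ∑' z, PMF.pure a z * f z = f a := by
  rw [tsum_eq_single a fun b hb => by simp [hb]]
  simp

theorem tsum_map_mul {α γ : Type*} (P : PMF α) (g : α → γ) (f : γ → ENNReal) :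
    ∑' z, P.map g z * f z = ∑' a, P a * f (g a) := by
  rw [PMF.map, tsum_bind_mul]
  simp only [Function.comp_apply, tsum_pure_mul]

theorem totalPot_nonneg (β ξ : ℝ) (y : Fin n → ℝ) : 0 ≤ totalPot β ξ y := by
  have := expPot_nonneg (1 * expRate β) y
  have := expPot_nonneg (-1 * expRate β) y
  unfold totalPot
  positivity

theorem totalPot_zero_le {β ξ : ℝ} (hβ : 0 < β) (hξ : 0 ≤ ξ) :
    totalPot β ξ (0 : Fin n → ℝ) ≤ 2 * n := by
  have h1 : spread (spreadRate β) (64 / β) (0 : Fin n → ℝ) = 0 := by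
    unfold spread radius
    have : 0 ≤ 64 / β * n := by positivity
    simp [Real.sqrt_sq this]
  have h2 : ∀ a, expPot a (0 : Fin n → ℝ) = n := by intro a; simp [expPot]
  have h3 := Real.exp_le_one_iff.2 (correction_nonpos (tauRate_nonneg hβ) 1 (0 : Fin n → ℝ))
  have h4 := Real.exp_le_one_iff.2 (correction_nonpos hξ (-1) (0 : Fin n → ℝ))
  unfold totalPot
  rw [h1, h2, h2, Real.exp_zero, one_mul, ← add_mul]
  gcongr
  linarith

theorem exp_gap_le {β ξ : ℝ} (hβ : 0 < β) (hβ1 : β ≤ 1) [NeZero n] (hξ : 0 ≤ ξ)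
    (hξ1 : ξ ≤ tauRate β) (x : Load n) :
    Real.exp (expRate β * gap x) ≤ Real.exp 1 * totalPot β ξ (dev x) := by
  obtain ⟨i, -, hi⟩ := exists_mem_eq_sup' univ_nonempty x
  have hgap : gap x = dev x i := by rw [gap, hi, dev]
  have h1 := le_totalPot hβ hβ1 (NeZero.pos n) hξ hξ1 (dev x)
  have h2 : Real.exp (expRate β * dev x i) ≤ expPot (expRate β) (dev x) :=
    single_le_sum (f := fun j => Real.exp (expRate β * dev x j)) (fun j _ => (Real.exp_pos _).le)
      (mem_univ i)
  have h3 := expPot_nonneg (-expRate β) (dev x)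
  have h4 : 1 ≤ Real.exp (spread (spreadRate β) (64 / β) (dev x)) :=
    Real.one_le_exp (spread_nonneg (spreadRate_nonneg hβ) _ _)
  rw [hgap]
  calc Real.exp (expRate β * dev x i)
      = Real.exp 1 * (1 * (Real.exp (-1) * Real.exp (expRate β * dev x i))) := by
        rw [Real.exp_neg]; field_simp
    _ ≤ Real.exp 1 * (Real.exp (spread (spreadRate β) (64 / β) (dev x)) *
      (Real.exp (-1) * (expPot (expRate β) (dev x) + expPot (-expRate β) (dev x)))) := by
        gcongr
        linarith
    _ ≤ _ := by gcongr

/-- Every process with biased steps has a logarithmic gap. -/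
theorem hasLogGap_of_biasedStep {Q : AllocProcess} {β ξ : ℝ} (hβ : 0 < β) (hβ1 : β ≤ 1)
    (hξ : 0 ≤ ξ) (hξ1 : ξ ≤ tauRate β)
    (hQ : ∀ (n : ℕ) [NeZero n] (t : ℕ), ∀ x ∈ (loadLaw Q n t).support,
      ∃ (p : Fin n → ℝ) (w : Fin n → ℕ), IsStep (Q n t x) x p w ∧
        BiasedStep β (dev x) p (fun i => (w i : ℝ)) ∧
        (ξ = tauRate β ∧ SamplesUnderloaded (dev x) p ∨
          ξ = 0 ∧ FavoursLowerHalf β (dev x) p (fun i => (w i : ℝ)))) : HasLogGap Q := by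
  obtain ⟨c, K, hc, hK, hstep⟩ := exists_sum_totalPot_le hβ hβ1
  have hα := expRate_pos hβ
  set B := 2 + K / c with hB
  have hB0 : 0 < B := by positivity
  -- The expected potential is at most `B * n`. Exponent 6 gives failure probability at most `exp 1
  -- * B * n ^ (-5)`, and one more factor `n` pays for `exp 1 * B`.
  refine ⟨6 / expRate β, by positivity, max 8 (max ⌈c⌉₊ ⌈Real.exp 1 * B⌉₊), fun n _ hn m => ?_⟩
  have hn8 : 8 ≤ n := le_trans (le_max_left _ _) hn
  have hn0 : (0 : ℝ) < n := by exact_mod_cast NeZero.pos n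
  have hnc : c ≤ n := Nat.ceil_le.1
    (le_trans (le_trans (le_max_left _ _) (le_max_right _ _)) hn)
  have hnB : Real.exp 1 * B ≤ n := Nat.ceil_le.1
    (le_trans (le_trans (le_max_right _ _) (le_max_right _ _)) hn)
  have hcn : 0 ≤ 1 - c / n := by
    rw [sub_nonneg, div_le_one hn0]; exact hnc
  have hE : ∀ t, ∑' x, loadLaw Q n t x * ENNReal.ofReal (totalPot β ξ (dev x)) ≤
      ENNReal.ofReal (B * n) := by
    intro t
    induction t with
    | zero =>
      have h0 : dev (fun _ => 0 : Load n) = 0 := by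
        funext i; simp [dev, meanLoad, totalLoad]
      rw [loadLaw, tsum_pure_mul, h0]
      refine ENNReal.ofReal_le_ofReal ((totalPot_zero_le hβ hξ).trans ?_)
      gcongr
      rw [hB]
      have : 0 < K / c := by positivity
      linarith
    | succ t ih =>
      rw [loadLaw, tsum_bind_mul]
      have h1 : ∀ x, loadLaw Q n t x * ∑' z, Q n t x z * ENNReal.ofReal (totalPot β ξ (dev z)) ≤
          ENNReal.ofReal (1 - c / n) * (loadLaw Q n t x * ENNReal.ofReal (totalPot β ξ (dev x))) +
            loadLaw Q n t x * ENNReal.ofReal K := by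
        intro x
        -- Only reachable loads matter; this lets later arguments identify the round with the number
        -- of balls.
        by_cases hx : loadLaw Q n t x = 0
        · simp [hx]
        obtain ⟨p, w, hs, hb, hl⟩ := hQ n t x ((PMF.mem_support_iff _ _).2 hx)
        have h2 := hstep n hn8 (dev x) p _ ξ hb (sum_dev x) hl
        have h3 : ∑' z, Q n t x z * ENNReal.ofReal (totalPot β ξ (dev z)) ≤
            ENNReal.ofReal (1 - c / n) * ENNReal.ofReal (totalPot β ξ (dev x)) +
              ENNReal.ofReal K := by
          rw [hs, ← ENNReal.ofReal_mul hcn,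
            ← ENNReal.ofReal_add (mul_nonneg hcn (totalPot_nonneg _ _ _)) hK.le]
          simp only [← ENNReal.ofReal_mul (hb.p_nonneg _)]
          rw [← ENNReal.ofReal_sum_of_nonneg fun i _ =>
            mul_nonneg (hb.p_nonneg i) (totalPot_nonneg _ _ _)]
          refine ENNReal.ofReal_le_ofReal (le_trans (le_of_eq ?_) h2)
          exact sum_congr rfl fun i _ => by rw [dev_allocate]
        calc _ ≤ loadLaw Q n t x * (ENNReal.ofReal (1 - c / n) *
              ENNReal.ofReal (totalPot β ξ (dev x)) + ENNReal.ofReal K) := by gcongr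
          _ = _ := by ring
      refine (ENNReal.tsum_le_tsum h1).trans ?_
      rw [ENNReal.tsum_add, ENNReal.tsum_mul_left, ENNReal.tsum_mul_right, PMF.tsum_coe, one_mul]
      calc _ ≤ ENNReal.ofReal (1 - c / n) * ENNReal.ofReal (B * n) + ENNReal.ofReal K := by gcongr
        _ = ENNReal.ofReal ((1 - c / n) * (B * n) + K) := by
            rw [← ENNReal.ofReal_mul hcn, ENNReal.ofReal_add (by positivity) hK.le]
        _ ≤ _ := by
            apply ENNReal.ofReal_le_ofReal
            have h4 : (1 - c / n) * (B * n) = B * n - c * B := by field_simp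
            have h5 : c * B = 2 * c + K := by rw [hB]; field_simp
            linarith
  set r := 6 / expRate β * Real.log n with hr
  have hexp : Real.exp (-(expRate β * r)) = ((n : ℝ) ^ 6)⁻¹ := by
    have : expRate β * r = Real.log ((n : ℝ) ^ 6) := by
      rw [Real.log_pow, hr]; field_simp; push_cast; ring
    rw [this, Real.exp_neg, Real.exp_log (by positivity)]
  have hmeas : MeasurableSet {x : Load n | gap x ≤ r} := (Set.to_countable _).measurableSet
  have htail : (loadLaw Q n m).toMeasure {x | gap x ≤ r}ᶜ ≤ ENNReal.ofReal ((n : ℝ) ^ 4)⁻¹ := by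
    rw [PMF.toMeasure_apply _ hmeas.compl]
    have h1 : ∀ x, Set.indicator {x | gap x ≤ r}ᶜ (loadLaw Q n m) x ≤
        loadLaw Q n m x * ENNReal.ofReal (totalPot β ξ (dev x)) *
          ENNReal.ofReal (Real.exp 1 * ((n : ℝ) ^ 6)⁻¹) := by
      intro x
      by_cases hx : gap x ≤ r
      · simp [hx]
      · rw [Set.indicator_of_mem (by simpa using hx), mul_assoc,
          ← ENNReal.ofReal_mul (totalPot_nonneg _ _ _)]
        refine le_mul_of_one_le_right (zero_le) ?_
        rw [ENNReal.one_le_ofReal]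
        have h2 := exp_gap_le hβ hβ1 hξ hξ1 x
        have h3 : Real.exp (expRate β * r) ≤ Real.exp (expRate β * gap x) := by
          apply Real.exp_le_exp.2
          gcongr
          exact (not_le.1 hx).le
        calc 1 = Real.exp (expRate β * r) * ((n : ℝ) ^ 6)⁻¹ := by
              rw [← hexp, ← Real.exp_add]; simp
          _ ≤ Real.exp 1 * totalPot β ξ (dev x) * ((n : ℝ) ^ 6)⁻¹ := by
              gcongr
              exact h3.trans h2
          _ = _ := by ring
    refine (ENNReal.tsum_le_tsum h1).trans ?_
    rw [ENNReal.tsum_mul_right]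
    calc _ ≤ ENNReal.ofReal (B * n) * ENNReal.ofReal (Real.exp 1 * ((n : ℝ) ^ 6)⁻¹) := by
          gcongr
          exact hE m
      _ = ENNReal.ofReal (B * n * (Real.exp 1 * ((n : ℝ) ^ 6)⁻¹)) := by
          rw [← ENNReal.ofReal_mul (by positivity)]
      _ ≤ _ := by
          apply ENNReal.ofReal_le_ofReal
          calc B * n * (Real.exp 1 * ((n : ℝ) ^ 6)⁻¹)
              = Real.exp 1 * B * (n * ((n : ℝ) ^ 6)⁻¹) := by ring
            _ ≤ n * (n * ((n : ℝ) ^ 6)⁻¹) := by gcongr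
            _ = _ := by field_simp
  have hreal : (loadLaw Q n m).toMeasure.real {x | gap x ≤ r}ᶜ ≤ ((n : ℝ) ^ 4)⁻¹ :=
    ENNReal.toReal_le_of_le_ofReal (by positivity) htail
  rw [MeasureTheory.probReal_compl_eq_one_sub hmeas] at hreal
  unfold probGapLE
  linarith

/-! ### Two-bin rules. -/

/-- A rule for choosing one of two bins that prefers bins below the mean and never depends on the
order of the two bins in favour of the fuller one. -/
structure PairRule (y : Fin n → ℝ) (c : Fin n → Fin n → Fin n) : Prop where
  mem : ∀ i j, c i j = i ∨ c i j = j
  symm : ∀ i j, (c i j = c j i ∧ y (c i j) ≤ y i ∧ y (c i j) ≤ y j) ∨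
    (c i j = i ∧ c j i = j) ∨ (c i j = j ∧ c j i = i)
  under : ∀ i j, y i < 0 → 0 ≤ y j → c i j = i ∧ c j i = i

/-- The probability that the rule chooses bin `k`. -/
def pairProb (c : Fin n → Fin n → Fin n) (k : Fin n) : ℝ :=
  (∑ i, ∑ j, if c i j = k then 1 else 0) / n ^ 2

/-- The rule is applied with probability `b`, otherwise the bin is uniform. -/
def mixProb (b : ℝ) (c : Fin n → Fin n → Fin n) (k : Fin n) : ℝ :=
  b * pairProb c k + (1 - b) / n

theorem pairProb_nonneg (c : Fin n → Fin n → Fin n) (k : Fin n) : 0 ≤ pairProb c k := by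
  unfold pairProb
  have : 0 ≤ ∑ i, ∑ j, if c i j = k then (1 : ℝ) else 0 :=
    sum_nonneg fun i _ => sum_nonneg fun j _ => by split_ifs <;> norm_num
  positivity

theorem sum_pairProb_mul (c : Fin n → Fin n → Fin n) (φ : Fin n → ℝ) :
    ∑ k, pairProb c k * φ k = (∑ i, ∑ j, φ (c i j)) / n ^ 2 := by
  have : ∀ k, pairProb c k * φ k = (∑ i, ∑ j, if c i j = k then φ k else 0) / n ^ 2 := by
    intro k
    simp only [pairProb, div_mul_eq_mul_div, sum_mul, ite_mul, one_mul, zero_mul]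
  simp only [this, ← sum_div]
  congr 1
  rw [sum_comm]
  refine sum_congr rfl fun i _ => ?_
  rw [sum_comm]
  exact sum_congr rfl fun j _ => by simp

theorem pairProb_le (c : Fin n → Fin n → Fin n) (hc : ∀ i j, c i j = i ∨ c i j = j) (k : Fin n) :
    pairProb c k ≤ 2 / n := by
  have hn : (0 : ℝ) < n := by exact_mod_cast k.pos
  have h : ∑ i, ∑ j, (if c i j = k then (1 : ℝ) else 0) ≤ 2 * n := by
    calc ∑ i, ∑ j, (if c i j = k then (1 : ℝ) else 0)
        ≤ ∑ i, ∑ j, ((if i = k then (1 : ℝ) else 0) + if j = k then 1 else 0) := by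
          refine sum_le_sum fun i _ => sum_le_sum fun j _ => ?_
          rcases hc i j with h | h <;> rw [h] <;> split_ifs <;> norm_num
      _ = 2 * n := by simp [sum_add_distrib]; ring
  calc pairProb c k ≤ 2 * n / n ^ 2 := by unfold pairProb; gcongr
    _ = 2 / n := by field_simp

theorem one_div_le_pairProb (c : Fin n → Fin n → Fin n) (k : Fin n) (hc : ∀ j, c k j = k) :
    1 / (n : ℝ) ≤ pairProb c k := by
  have hn : (0 : ℝ) < n := by exact_mod_cast k.pos
  have h : (n : ℝ) ≤ ∑ i, ∑ j, (if c i j = k then (1 : ℝ) else 0) := by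
    calc (n : ℝ) = ∑ j, (if c k j = k then (1 : ℝ) else 0) := by simp [hc]
      _ ≤ _ := single_le_sum (f := fun i => ∑ j, (if c i j = k then (1 : ℝ) else 0))
        (fun i _ => sum_nonneg fun j _ => by split_ifs <;> norm_num) (mem_univ k)
  calc 1 / (n : ℝ) = n / n ^ 2 := by field_simp
    _ ≤ _ := by unfold pairProb; gcongr

theorem sum_mixProb_mul (b : ℝ) (c : Fin n → Fin n → Fin n) (φ : Fin n → ℝ) :
    ∑ k, mixProb b c k * φ k = b * ((∑ i, ∑ j, φ (c i j)) / n ^ 2) + (1 - b) / n * ∑ i, φ i := by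
  rw [← sum_pairProb_mul, mul_sum, mul_sum, ← sum_add_distrib]
  exact sum_congr rfl fun k _ => by unfold mixProb; ring

theorem sum_mixProb (hn : 0 < n) (b : ℝ) (c : Fin n → Fin n → Fin n) :
    ∑ k, mixProb b c k = 1 := by
  have hn0 : (n : ℝ) ≠ 0 := by positivity
  have := sum_mixProb_mul b c fun _ => 1
  simp only [mul_one, sum_const, card_univ, Fintype.card_fin, nsmul_eq_mul] at this
  rw [this]
  field_simp
  ring

theorem sum_drift_mixProb (hn : 0 < n) (b : ℝ) (c : Fin n → Fin n → Fin n) (φ : Fin n → ℝ) :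
    ∑ k, drift (mixProb b c) (fun _ => ((1 : ℕ) : ℝ)) k * φ k =
      b * ((∑ i, ∑ j, φ (c i j)) / n ^ 2 - (∑ i, φ i) / n) := by
  simp only [drift, Nat.cast_one, mul_one, sum_mixProb hn, sub_mul, sum_sub_distrib,
    sum_mixProb_mul, ← mul_sum]
  ring

theorem sum_sum_symm (g : Fin n → Fin n → ℝ) :
    2 * ∑ i, ∑ j, g i j = ∑ i, ∑ j, (g i j + g j i) := by
  simp only [sum_add_distrib]
  rw [sum_comm (f := fun i j => g j i)]
  ring

theorem card_over (hn : 0 < n) (y : Fin n → ℝ) :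
    ∑ j, (if 0 ≤ y j then (1 : ℝ) else 0) = n * overFrac y := by
  have hn0 : (n : ℝ) ≠ 0 := by positivity
  unfold overFrac
  rw [mul_div_cancel₀ _ hn0]
  simp

theorem sum_sum_mul_over (hn : 0 < n) (y φ : Fin n → ℝ) :
    ∑ i, ∑ j, (φ i * (if 0 ≤ y j then (1 : ℝ) else 0) + φ j * (if 0 ≤ y i then (1 : ℝ) else 0)) =
      2 * (n * overFrac y * ∑ i, φ i) := by
  rw [← sum_sum_symm fun i j => φ i * (if 0 ≤ y j then (1 : ℝ) else 0)]
  simp only [← mul_sum, card_over hn, ← sum_mul]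
  ring

namespace PairRule

variable {y : Fin n → ℝ} {c : Fin n → Fin n → Fin n}

/-- Both orders of a pair are added up. An overloaded pair contributes at most `φ i + φ j`, and
every other pair contributes nothing since the rule selects an underloaded bin. -/
theorem sum_sum_over_le (h : PairRule y c) (hn : 0 < n) {φ : Fin n → ℝ} (h0 : ∀ i, 0 ≤ φ i)
    (hz : ∀ i, y i < 0 → φ i = 0) (hm : ∀ i j, y i ≤ y j → φ i ≤ φ j) :
    ∑ i, ∑ j, φ (c i j) ≤ n * overFrac y * ∑ i, φ i := by
  have h1 : ∑ i, ∑ j, (φ (c i j) + φ (c j i)) ≤ ∑ i, ∑ j,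
      (φ i * (if 0 ≤ y j then (1 : ℝ) else 0) + φ j * (if 0 ≤ y i then (1 : ℝ) else 0)) := by
    refine sum_le_sum fun i _ => sum_le_sum fun j _ => ?_
    have hi := h0 i
    have hj := h0 j
    rcases lt_or_ge (y i) 0 with hyi | hyi <;> rcases lt_or_ge (y j) 0 with hyj | hyj
    · rcases h.mem i j with e | e <;> rcases h.mem j i with e' | e' <;>
        simp [e, e', hz i hyi, hz j hyj]
    · obtain ⟨e, e'⟩ := h.under i j hyi hyj
      simp [e, e', hz i hyi, hyi.not_ge]
    · obtain ⟨e, e'⟩ := h.under j i hyj hyi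
      simp [e, e', hz j hyj, hyj.not_ge]
    · simp only [hyi, hyj, if_true, mul_one]
      rcases h.symm i j with ⟨e, e1, e2⟩ | ⟨e, e'⟩ | ⟨e, e'⟩
      · rw [← e]; exact add_le_add (hm _ _ e1) (hm _ _ e2)
      · rw [e, e']
      · rw [e, e', add_comm]
  rw [← sum_sum_symm, sum_sum_mul_over hn] at h1
  linarith

/-- Over both orders, a mixed pair counts its underloaded bin twice and an underloaded pair gives at
least `φ i + φ j`. The doubled mixed pairs are the gain over uniform choice. -/
theorem le_sum_sum_under (h : PairRule y c) (hn : 0 < n) {φ : Fin n → ℝ} (h0 : ∀ i, 0 ≤ φ i)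
    (hz : ∀ i, 0 ≤ y i → φ i = 0) (hm : ∀ i j, y i ≤ y j → φ j ≤ φ i) :
    n * (1 + overFrac y) * ∑ i, φ i ≤ ∑ i, ∑ j, φ (c i j) := by
  have h1 : ∑ i, ∑ j, (φ i + φ j + (φ i * (if 0 ≤ y j then (1 : ℝ) else 0) +
      φ j * (if 0 ≤ y i then (1 : ℝ) else 0))) ≤ ∑ i, ∑ j, (φ (c i j) + φ (c j i)) := by
    refine sum_le_sum fun i _ => sum_le_sum fun j _ => ?_
    rcases lt_or_ge (y i) 0 with hyi | hyi <;> rcases lt_or_ge (y j) 0 with hyj | hyj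
    · simp only [hyi.not_ge, hyj.not_ge, if_false, mul_zero, add_zero]
      rcases h.symm i j with ⟨e, e1, e2⟩ | ⟨e, e'⟩ | ⟨e, e'⟩
      · rw [← e]; exact add_le_add (hm _ _ e1) (hm _ _ e2)
      · rw [e, e']
      · rw [e, e', add_comm]
    · obtain ⟨e, e'⟩ := h.under i j hyi hyj
      simp [e, e', hz j hyj, hyj]
    · obtain ⟨e, e'⟩ := h.under j i hyj hyi
      simp [e, e', hz i hyi, hyi]
    · simp only [hz i hyi, hz j hyj, zero_mul, add_zero]
      exact add_nonneg (h0 _) (h0 _)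
  rw [← sum_sum_symm] at h1
  simp only [sum_add_distrib (f := fun j => φ _ + φ j), sum_add_distrib (f := fun i => ∑ j, (φ i + φ j))] at h1
  rw [sum_sum_mul_over hn, ← sum_sum_symm fun i j => φ i] at h1
  simp only [sum_const, card_univ, Fintype.card_fin, nsmul_eq_mul, ← mul_sum] at h1
  linarith

theorem biasedStep (h : PairRule y c) (hn : 0 < n) {b : ℝ} (hb : 0 ≤ b) (hb1 : b ≤ 1) :
    BiasedStep b y (mixProb b c) (fun _ => ((1 : ℕ) : ℝ)) where
  p_nonneg k := by
    have := pairProb_nonneg c k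
    have : 0 ≤ 1 - b := by linarith
    unfold mixProb; positivity
  p_sum := sum_mixProb hn b c
  p_le k := by
    have h1 := mul_le_mul_of_nonneg_left (pairProb_le c h.mem k) hb
    have h2 : (1 - b) / n ≤ (1 - b) * (2 / n) := by
      rw [mul_div_assoc']
      gcongr
      linarith
    unfold mixProb
    linarith
  one_le_w _ := by norm_num
  w_le_two _ := by norm_num
  drift_over φ h0 hz hm := by
    have hn0 : (0 : ℝ) < n := by exact_mod_cast hn
    rw [sum_drift_mixProb hn]
    have h1 := h.sum_sum_over_le hn h0 hz hm
    have hs := BiasedStep.underFrac_add_overFrac hn y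
    calc b * ((∑ i, ∑ j, φ (c i j)) / n ^ 2 - (∑ i, φ i) / n)
        ≤ b * (n * overFrac y * (∑ i, φ i) / n ^ 2 - (∑ i, φ i) / n) := by gcongr
      _ = _ := by
        rw [← eq_sub_iff_add_eq] at hs
        rw [hs]; field_simp; ring
  drift_under φ h0 hz hm := by
    have hn0 : (0 : ℝ) < n := by exact_mod_cast hn
    rw [sum_drift_mixProb hn]
    have h1 := h.le_sum_sum_under hn h0 hz hm
    calc _ = b * (n * (1 + overFrac y) * (∑ i, φ i) / n ^ 2 - (∑ i, φ i) / n) := by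
          field_simp; ring
      _ ≤ _ := by gcongr

theorem favoursLowerHalf (hn : 0 < n) {b : ℝ} (hb : 0 ≤ b)
    (hmin : ∀ i j, y (c i j) ≤ y i ∧ y (c i j) ≤ y j) :
    FavoursLowerHalf b y (mixProb b c) (fun _ => ((1 : ℕ) : ℝ)) := by
  intro φ h0 hm M hM
  have hn0 : (0 : ℝ) < n := by exact_mod_cast hn
  rw [sum_drift_mixProb hn]
  set Φ := ∑ i, φ i with hΦ
  set N := (#{i | φ i ≤ M} : ℝ) with hN
  have hc1 : ∀ i j, φ i + φ j ≤ 2 * φ (c i j) := fun i j => by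
    linarith [hm _ _ (hmin i j).1, hm _ _ (hmin i j).2]
  have hbase : n * Φ ≤ ∑ i, ∑ j, φ (c i j) := by
    have h1 : ∑ i, ∑ j, (φ i + φ j) ≤ ∑ i, ∑ j, 2 * φ (c i j) :=
      sum_le_sum fun i _ => sum_le_sum fun j _ => hc1 i j
    rw [← sum_sum_symm fun i j => φ i] at h1
    simp only [sum_const, card_univ, Fintype.card_fin, nsmul_eq_mul, ← mul_sum] at h1
    linarith
  have key : 2 * n * Φ + (n * (Φ - n * M)) ≤ 2 * ∑ i, ∑ j, φ (c i j) := by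
    rcases le_total (Φ - n * M) 0 with hneg | hpos
    · nlinarith
    -- The chosen bin has `φ` at least the larger of `φ i` and `φ j`. Whenever one bin of the pair
    -- lies at or below `M`, this gains the excess of the other over `M`; at least half of the bins
    -- can play that part.
    · have h1 : ∑ i, ∑ j, (φ i + φ j + ((φ i - M) * (if φ j ≤ M then (1 : ℝ) else 0) +
          (φ j - M) * (if φ i ≤ M then (1 : ℝ) else 0))) ≤ ∑ i, ∑ j, 2 * φ (c i j) := by
        refine sum_le_sum fun i _ => sum_le_sum fun j _ => ?_
        have h2 := hm _ _ (hmin i j).1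
        have h3 := hm _ _ (hmin i j).2
        split_ifs <;> linarith
      simp only [sum_add_distrib (f := fun j => φ _ + φ j),
        sum_add_distrib (f := fun i => ∑ j, (φ i + φ j))] at h1
      rw [← sum_sum_symm fun i j => φ i,
        ← sum_sum_symm fun i j => (φ i - M) * (if φ j ≤ M then (1 : ℝ) else 0)] at h1
      simp only [← mul_sum, ← sum_mul, sum_const, card_univ, Fintype.card_fin, nsmul_eq_mul,
        sum_sub_distrib, sum_boole] at h1
      have h4 : n * (Φ - n * M) ≤ 2 * N * (Φ - n * M) := by gcongr
      linarith
  have h5 : b / (2 * n) * (Φ - n * M) =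
      b * (((2 * n * Φ + (n * (Φ - n * M))) / 2) / n ^ 2 - Φ / n) := by field_simp; ring
  rw [h5]
  gcongr
  linarith

end PairRule

/-! ### Laws of the processes and their biases. -/

theorem tsum_sampleBin_mul [NeZero n] (f : Fin n → ENNReal) :
    ∑' i, sampleBin n i * f i = (n : ENNReal)⁻¹ * ∑ i, f i := by
  rw [tsum_fintype, mul_sum]
  simp [sampleBin]

/-- Sample two bins and put one ball into the one chosen by `c`. -/
def pairLaw [NeZero n] (x : Load n) (c : Fin n → Fin n → Fin n) : PMF (Load n) :=
  (sampleBin n).bind fun i₁ => (sampleBin n).map fun i₂ => allocate x (c i₁ i₂) 1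

theorem isStep_pairLaw [NeZero n] (x : Load n) (c : Fin n → Fin n → Fin n) :
    IsStep (pairLaw x c) x (pairProb c) (fun _ => 1) := by
  intro f
  have hn0 : (0 : ℝ) < n := by exact_mod_cast NeZero.pos n
  have hp : ∀ k, ENNReal.ofReal (pairProb c k) =
      (n : ENNReal)⁻¹ * ((n : ENNReal)⁻¹ * ∑ i, ∑ j, if c i j = k then 1 else 0) := by
    intro k
    have h : pairProb c k =
        (n : ℝ)⁻¹ * ((n : ℝ)⁻¹ * ((∑ i, ∑ j, if c i j = k then 1 else 0 : ℕ) : ℝ)) := by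
      unfold pairProb; push_cast; field_simp
    rw [h, ENNReal.ofReal_mul (by positivity), ENNReal.ofReal_mul (by positivity),
      ENNReal.ofReal_inv_of_pos hn0, ENNReal.ofReal_natCast, ENNReal.ofReal_natCast]
    push_cast
    rfl
  rw [pairLaw, tsum_bind_mul]
  simp only [tsum_map_mul, tsum_sampleBin_mul, hp]
  rw [← mul_sum]
  simp only [mul_assoc, ← mul_sum]
  congr 2
  simp only [sum_mul, ite_mul, one_mul, zero_mul]
  symm
  rw [sum_comm]
  refine sum_congr rfl fun i _ => ?_
  rw [sum_comm]
  exact sum_congr rfl fun j _ => by simp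

theorem mem_support_pairLaw [NeZero n] {x z : Load n} {c : Fin n → Fin n → Fin n}
    (hz : z ∈ (pairLaw x c).support) : totalLoad z = totalLoad x + 1 := by
  simp only [pairLaw, PMF.mem_support_bind_iff, PMF.mem_support_map_iff] at hz
  obtain ⟨i, -, j, -, rfl⟩ := hz
  exact totalLoad_allocate _ _ _

/-- Makes the threshold `t / n` equal to the mean load along every reachable trajectory. -/
theorem totalLoad_of_mem_support {Q : AllocProcess} [NeZero n]
    (hQ : ∀ t x, ∀ z ∈ (Q n t x).support, totalLoad z = totalLoad x + 1) (t : ℕ) :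
    ∀ x ∈ (loadLaw Q n t).support, totalLoad x = t := by
  induction t with
  | zero =>
    intro x hx
    rw [loadLaw, PMF.mem_support_pure_iff] at hx
    simp [hx, totalLoad]
  | succ t ih =>
    intro x hx
    rw [loadLaw, PMF.mem_support_bind_iff] at hx
    obtain ⟨a, ha, hx⟩ := hx
    rw [hQ t a x hx, ih a ha]

theorem dev_le_dev {x : Load n} {i j : Fin n} : dev x i ≤ dev x j ↔ x i ≤ x j := by
  simp [dev]

theorem mixProb_one (c : Fin n → Fin n → Fin n) : mixProb 1 c = pairProb c := by
  funext k; simp [mixProb]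

/-- A process that applies a two-bin rule has a logarithmic gap, if the rule takes the first bin
whenever that is below the mean. -/
theorem hasLogGap_of_pairRule {Q : AllocProcess} (c : ∀ n : ℕ, ℕ → Load n → Fin n → Fin n → Fin n)
    (hQ : ∀ (n : ℕ) [NeZero n] (t : ℕ) (x : Load n), Q n t x = pairLaw x (c n t x))
    (hc : ∀ (n : ℕ) [NeZero n] (x : Load n), PairRule (dev x) (c n (totalLoad x) x) ∧
      ∀ i j, dev x i < 0 → c n (totalLoad x) x i j = i) : HasLogGap Q := by
  refine hasLogGap_of_biasedStep (β := 1) one_pos le_rfl (tauRate_nonneg one_pos) le_rfl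
    fun n _ t x hx => ?_
  have ht : totalLoad x = t := totalLoad_of_mem_support (fun t x z hz => by
    rw [hQ] at hz
    exact mem_support_pairLaw hz) t x hx
  obtain ⟨h1, h2⟩ := hc n x
  rw [ht] at h1 h2
  refine ⟨pairProb (c n t x), fun _ => 1, ?_, ?_, Or.inl ⟨rfl, ?_⟩⟩
  · rw [hQ]
    exact isStep_pairLaw x _
  · rw [← mixProb_one]
    exact h1.biasedStep (NeZero.pos n) zero_le_one le_rfl
  · exact fun i hi => one_div_le_pairProb _ i fun j => h2 i j hi

theorem hasLogGap_meanThinning : HasLogGap meanThinning := by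
  refine hasLogGap_of_pairRule
    (fun n t x i₁ i₂ => if (x i₁ : ℝ) < (t : ℝ) / (n : ℝ) then i₁ else i₂)
    (fun n _ t x => rfl) fun n _ x => ?_
  have h : ∀ i, (x i : ℝ) < (totalLoad x : ℝ) / (n : ℝ) ↔ dev x i < 0 := fun i => by
    rw [dev, meanLoad, sub_neg]
  simp only [h]
  refine ⟨⟨fun i j => ?_, fun i j => ?_, fun i j hi hj => ?_⟩, fun i j hi => if_pos hi⟩
  · by_cases hi : dev x i < 0 <;> simp [hi]
  · by_cases hi : dev x i < 0 <;> by_cases hj : dev x j < 0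
    · simp [hi, hj]
    · simp only [hi, hj, if_true, if_false]
      exact Or.inl ⟨trivial, le_rfl, by linarith⟩
    · simp only [hi, hj, if_true, if_false]
      exact Or.inl ⟨trivial, by linarith, le_rfl⟩
    · simp [hi, hj]
  · simp [hi, hj.not_gt]

theorem level_anti (k : ℕ) (f : ℕ → ℕ → ℝ) (n t : ℕ) {a b : ℕ} (h : a ≤ b) :
    level k f n t b ≤ level k f n t a := by
  unfold level
  refine sup_mono fun j hj => ?_
  have h' : (a : ℝ) ≤ b := by exact_mod_cast h
  simp only [mem_filter] at hj ⊢
  refine ⟨hj.1, hj.2.imp_right fun h2 => ?_⟩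
  linarith

theorem level_le (k : ℕ) (f : ℕ → ℕ → ℝ) (n t a : ℕ) : level k f n t a ≤ k := by
  unfold level
  refine Finset.sup_le fun j hj => ?_
  have := mem_range.1 (mem_filter.1 hj).1
  simp only [id]
  lia

theorem level_eq_iff {k : ℕ} (hk : 1 ≤ k) (f : ℕ → ℕ → ℝ) {n : ℕ} (hf : f k n = 0) (t a : ℕ) :
    level k f n t a = k ↔ (a : ℝ) < (t : ℝ) / (n : ℝ) := by
  constructor
  · intro h
    by_contra hn
    have : level k f n t a ≤ k - 1 := by
      unfold level
      refine Finset.sup_le fun j hj => ?_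
      simp only [mem_filter, mem_range] at hj
      simp only [id]
      -- Index 0 always belongs to the set, but `k ≥ 1` keeps it from being `k`.
      have hjk : j ≠ k := by
        rintro rfl
        rcases hj.2 with h0 | h0
        · lia
        · rw [hf] at h0
          exact hn (by linarith)
      lia
    lia
  · intro h
    refine le_antisymm (level_le k f n t a) ?_
    unfold level
    refine le_sup (f := id) (mem_filter.2 ⟨mem_range.2 (by lia), Or.inr ?_⟩)
    rw [hf]
    linarith

/-- A higher level means a smaller load, equal levels give the first bin in either order, and `f k n
= 0` makes the top level the set of underloaded bins. -/
theorem hasLogGap_relativeThreshold {k : ℕ} (hk : 1 ≤ k) (f : ℕ → ℕ → ℝ)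
    (hf : ∀ n : ℕ, 1 ≤ n → f k n = 0) : HasLogGap (relativeThreshold k f) := by
  refine hasLogGap_of_pairRule
    (fun n t x i₁ i₂ => if level k f n t (x i₁) ≥ level k f n t (x i₂) then i₁ else i₂)
    (fun n _ t x => rfl) fun n _ x => ?_
  set L := fun i => level k f n (totalLoad x) (x i) with hL
  have hu : ∀ i, L i = k ↔ dev x i < 0 := fun i => by
    rw [dev, meanLoad, sub_neg]
    exact level_eq_iff hk f (hf n (NeZero.pos n)) _ _
  have hle : ∀ i, L i ≤ k := fun i => level_le k f n _ _
  have hlt : ∀ i j, L i < L j → dev x j ≤ dev x i := fun i j hij => by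
    rw [dev_le_dev]
    by_contra hx
    exact hij.not_ge (level_anti k f n _ (not_le.1 hx).le)
  change PairRule (dev x) (fun i j => if L i ≥ L j then i else j) ∧
    ∀ i j, dev x i < 0 → (if L i ≥ L j then i else j) = i
  refine ⟨⟨fun i j => ?_, fun i j => ?_, fun i j hi hj => ?_⟩, fun i j hi => ?_⟩
  · by_cases h : L i ≥ L j <;> simp [h]
  · rcases lt_trichotomy (L i) (L j) with h | h | h
    · simp only [ge_iff_le, h.not_ge, h.le, if_true, if_false]
      exact Or.inl ⟨trivial, hlt i j h, le_rfl⟩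
    · simp [h]
    · simp only [ge_iff_le, h.not_ge, h.le, if_true, if_false]
      exact Or.inl ⟨trivial, le_rfl, hlt j i h⟩
  · have h1 := (hu i).2 hi
    have h2 : L j < L i := lt_of_le_of_ne (h1 ▸ hle j) fun e =>
      hj.not_gt ((hu j).1 (e.trans h1))
    simp [h2.le, h2.not_ge]
  · rw [if_pos]
    rw [(hu i).2 hi]
    exact hle j

theorem hasLogGap_twinning : HasLogGap twinning := by
  refine hasLogGap_of_biasedStep (β := 1) one_pos le_rfl (tauRate_nonneg one_pos) le_rfl
    fun n _ t x _ => ?_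
  have hn := NeZero.pos n
  have hn0 : (0 : ℝ) < n := by exact_mod_cast hn
  set w : Fin n → ℕ := fun i => if (x i : ℝ) < meanLoad x then 2 else 1 with hw
  have hw' : ∀ i, (w i : ℝ) = 1 + if dev x i < 0 then 1 else 0 := fun i => by
    simp only [hw, dev, sub_neg]
    split_ifs <;> norm_num
  have hsum : ∑ j, 1 / (n : ℝ) * (w j : ℝ) = 1 + underFrac (dev x) := by
    simp only [hw', ← mul_sum, sum_add_distrib, underFrac]
    simp
    field_simp
  have hs := BiasedStep.underFrac_add_overFrac hn (dev x)
  -- The drift is constant on each side of the mean, so both bias conditions hold with equality for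
  -- `β = 1`.
  have hd : ∀ i, drift (fun _ => 1 / (n : ℝ)) (fun i => (w i : ℝ)) i =
      ((if dev x i < 0 then 1 else 0) - underFrac (dev x)) / n := fun i => by
    rw [drift, hsum, hw']; ring
  refine ⟨fun _ => 1 / n, w, ?_, ?_, Or.inl ⟨rfl, fun _ _ => le_rfl⟩⟩
  · intro f
    rw [twinning, tsum_map_mul, tsum_sampleBin_mul, mul_sum]
    simp only [one_div, ENNReal.ofReal_inv_of_pos hn0, ENNReal.ofReal_natCast, hw]
  · refine ⟨fun _ => by positivity, ?_, fun _ => by gcongr; norm_num, fun i => ?_, fun i => ?_,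
      fun φ _ hz _ => le_of_eq ?_, fun φ _ hz _ => le_of_eq ?_⟩
    · simp [hn.ne']
    · rw [hw']; split_ifs <;> norm_num
    · rw [hw']; split_ifs <;> norm_num
    · rw [mul_sum, ← sum_neg_distrib]
      refine sum_congr rfl fun i _ => ?_
      rw [hd]
      by_cases hi : dev x i < 0
      · simp [hz i hi]
      · simp only [hi, if_false]; ring
    · rw [mul_sum]
      refine sum_congr rfl fun i _ => ?_
      rw [hd]
      by_cases hi : dev x i < 0
      · simp only [hi, if_true, ← eq_sub_of_add_eq' hs]; ring
      · simp [hz i (not_lt.1 hi)]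

/-- The choice of the two-choice process. -/
def lessLoaded (x : Load n) (i₁ i₂ : Fin n) : Fin n :=
  if x i₁ < x i₂ then i₁ else if x i₂ < x i₁ then i₂ else max i₁ i₂

theorem dev_lessLoaded_le (x : Load n) (i j : Fin n) :
    dev x (lessLoaded x i j) ≤ dev x i ∧ dev x (lessLoaded x i j) ≤ dev x j := by
  simp only [dev_le_dev]
  unfold lessLoaded
  split_ifs with h1 h2
  · exact ⟨le_rfl, h1.le⟩
  · exact ⟨h2.le, le_rfl⟩
  · rcases max_choice i j with h | h <;> rw [h] <;> lia

theorem lessLoaded_comm (x : Load n) (i j : Fin n) : lessLoaded x i j = lessLoaded x j i := by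
  unfold lessLoaded
  split_ifs with h1 h2 h3 <;> first | rfl | exact max_comm _ _ | lia

theorem lessLoaded_mem (x : Load n) (i j : Fin n) : lessLoaded x i j = i ∨ lessLoaded x i j = j := by
  unfold lessLoaded
  split_ifs
  · exact Or.inl rfl
  · exact Or.inr rfl
  · exact max_choice i j

theorem pairRule_lessLoaded (x : Load n) : PairRule (dev x) (lessLoaded x) where
  mem := lessLoaded_mem x
  symm i j := Or.inl ⟨lessLoaded_comm x i j, dev_lessLoaded_le x i j⟩
  under i j hi hj := by
    rw [lessLoaded_comm x j i, and_self]
    refine (lessLoaded_mem x i j).resolve_right fun h => ?_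
    have := (dev_lessLoaded_le x i j).1
    rw [h] at this
    linarith

theorem isStep_onePlusBeta [NeZero n] (β : unitInterval) (t : ℕ) (x : Load n) :
    IsStep (onePlusBeta β n t x) x (mixProb β (lessLoaded x)) (fun _ => 1) := by
  intro f
  have hn0 : (0 : ℝ) < n := by exact_mod_cast NeZero.pos n
  have hβ0 : (0 : ℝ) ≤ β := β.2.1
  have hβ1 : (0 : ℝ) ≤ 1 - β := sub_nonneg.2 β.2.2
  have htwo : ∑' z, twoChoice n t x z * f z =
      ∑ k, ENNReal.ofReal (pairProb (lessLoaded x) k) * f (allocate x k 1) :=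
    isStep_pairLaw x (lessLoaded x) f
  have hone : ∑' z, oneChoice n t x z * f z =
      ∑ k, ENNReal.ofReal (1 / n) * f (allocate x k 1) := by
    rw [oneChoice, tsum_map_mul, tsum_sampleBin_mul, mul_sum, one_div,
      ENNReal.ofReal_inv_of_pos hn0, ENNReal.ofReal_natCast]
  rw [onePlusBeta, tsum_bind_mul, tsum_fintype, Fintype.sum_bool]
  simp only [coin, PMF.ofFintype_apply, if_true, Bool.false_eq_true, if_false]
  rw [htwo, hone, mul_sum, mul_sum, ← sum_add_distrib]
  refine sum_congr rfl fun k _ => ?_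
  rw [← mul_assoc, ← mul_assoc, ← ENNReal.ofReal_mul hβ0, ← ENNReal.ofReal_mul hβ1, ← add_mul,
    ← ENNReal.ofReal_add (mul_nonneg hβ0 (pairProb_nonneg _ _)) (by positivity), mul_one_div]
  rfl

/-- The fuller underloaded bins may be chosen with probability below `1 / n`, so the lower side runs
with `ξ = 0` and `FavoursLowerHalf`. -/
theorem hasLogGap_onePlusBeta {β : unitInterval} (hβ : 0 < β) : HasLogGap (onePlusBeta β) := by
  have h0 : (0 : ℝ) < β := hβ
  refine hasLogGap_of_biasedStep (β := β) h0 β.2.2 le_rfl (tauRate_nonneg h0)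
    fun n _ t x _ => ⟨_, _, isStep_onePlusBeta β t x, ?_, Or.inr ⟨rfl, ?_⟩⟩
  · exact (pairRule_lessLoaded x).biasedStep (NeZero.pos n) h0.le β.2.2
  · exact PairRule.favoursLowerHalf (NeZero.pos n) h0.le (dev_lessLoaded_le x)

end BallsBins

end

theorem corollary3p5 :
    BallsBins.HasLogGap BallsBins.twinning ∧
    (∀ (k : ℕ) (f : ℕ → ℕ → ℝ), 1 ≤ k →
      (∀ n : ℕ, 1 ≤ n → ∀ i j : ℕ, 1 ≤ i → i < j → j ≤ k → f j n < f i n) →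
      (∀ n : ℕ, 1 ≤ n → f k n = 0) →
      BallsBins.HasLogGap (BallsBins.relativeThreshold k f)) ∧
    BallsBins.HasLogGap BallsBins.meanThinning ∧
    (∀ β : unitInterval, 0 < β → BallsBins.HasLogGap (BallsBins.onePlusBeta β)) :=
  ⟨BallsBins.hasLogGap_twinning,
    fun _ f hk _ hf => BallsBins.hasLogGap_relativeThreshold hk f hf,
    BallsBins.hasLogGap_meanThinning, fun _ hβ => BallsBins.hasLogGap_onePlusBeta hβ⟩
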